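/- Let $d\in\{2,3\}$ and $\sigma>0$. There is $\rho_0>0$, depending only on $d$ and $\sigma$, such that the following holds for every $\rho\ge\rho_0$. **Mesh.** Let $\Omega\subset\mathbb R^d$ be a bounded connected open set with $\operatorname{int}\overline\Omega=\Omega$ (for instance a bounded Lipschitz domain), and let $\mathcal T_h$ be a conforming mesh of $\overline\Omega$ by nondegenerate closed simplices that is shape regular: every $K\in\mathcal T_h$ contains a ball of some radius $r>0$ with $\operatorname{diam}K\le\sigma r$. Let $\mathcal E_h$ be the set of edges ($d=2$) or faces ($d=3$) of the mesh. An interior $e\in\mathcal E_h$ is shared by two elements $K^+,K^-$ (in a fixed, arbitrary order), and $\mathbf n_e$ is its unit normal pointing from $K^+$ to $K^-$; on a boundary $e$, $\mathbf n_e$ points out of $\Omega$. For a piecewise smooth $g$ put $[\![g]\!]=g^+-g^-$ and $\{g\}=\frac12(g^++g^-)$ on interior $e$, and $[\![g]\!]=\{g\}=g$ on boundary $e$. Put $h_e=|e|^{1/(d-1)}$. **Spaces.** Let $\mathbf C_h=\{\mathbf v\in[H^1_0(\Omega)]^d:\mathbf v|_K\in[\mathbb P_1(K)]^d\ \forall K\in\mathcal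 T_h\}$, let $\mathbf D_h$ be the set of fields with $\mathbf v|_K=c_K(\mathbf x-\mathbf x_K)$, $c_K\in\mathbb R$, for all $K\in\mathcal T_h$, where $\mathbf x_K$ is the centroid of $K$, and let $\mathbf V_h=\mathbf C_h+\mathbf D_h$. Let $Q_h$ be the space of functions that are constant on each $K\in\mathcal T_h$ and have mean zero on $\Omega$. On $\mathbf V_h$ let $$\|\mathbf v\|_{\mathcal E}=\Big(\sum_{K}\|\nabla\mathbf v\|_{0,K}^2+\rho\sum_{e}h_e^{-1}\|[\![\mathbf v]\!]\|_{0,e}^2\Big)^{1/2},$$ and let $$\mathbf b(\mathbf w,q)=\sum_K(\nabla\cdot\mathbf w,q)_K-\sum_e\langle[\![\mathbf w]\!]\cdot\mathbf n_e,\{q\}\rangle_e .$$ **Reconstruction.** Let $\mathrm{BDM}_1$ be the space of piecewise $[\mathbb P_1]^d$ fields whose normal component is continuous across every interior $e$ (that is, the $H(\mathrm{div},\Omega)$-conforming ones). For every $\mathbf v\in\mathbf V_h$ there is exactly one $\mathcal R\mathbf v\in\mathrm{BDM}_1$ such that, for all $p_1\in\mathbb P_1(e)$, $\int_e\mathcal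 R\mathbf v\cdot\mathbf n_e\,p_1\,ds=\int_e\{\mathbf v\}\cdot\mathbf n_e\,p_1\,ds$ on each interior $e$, and $\int_e\mathcal R\mathbf v\cdot\mathbf n_e\,p_1\,ds=0$ on each boundary $e$. **Well-posedness.** Let $\nu>0$, let $\mathbf f\in[L^2(\Omega)]^d$, and let $\mathbf a^D:\mathbf V_h\times\mathbf V_h\to\mathbb R$ be any bilinear form for which there are constants $\kappa_1^D,\kappa_2^D>0$ with $$\mathbf a^D(\mathbf v,\mathbf v)\ge\kappa_1^D\nu\|\mathbf v\|_{\mathcal E}^2,\qquad|\mathbf a^D(\mathbf v,\mathbf w)|\le\kappa_2^D\nu\|\mathbf v\|_{\mathcal E}\|\mathbf w\|_{\mathcal E}\qquad\forall\,\mathbf v,\mathbf w\in\mathbf V_h .$$ Then the perturbed pressure-robust enriched Galerkin method has exactly one solution: there is a unique $(\mathbf u_h,p_h)\in\mathbf V_h\times Q_h$ such that $$\mathbf a^D(\mathbf u_h,\mathbf v)-\mathbf b(\mathbf v,p_h)=(\mathbf f,\mathcal R\mathbf v)\quad\forall\,\mathbf v\in\mathbf V_h,\qquad\mathbf b(\mathbf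 u_h,q)=0\quad\forall\,q\in Q_h .$$ -/

import Mathlib

open MeasureTheory Filter Topology
open scoped ENNReal ContDiff

noncomputable section

namespace EG

/-- `ℝ^d` with its Euclidean norm. -/
abbrev Space (d : ℕ) : Type := EuclideanSpace ℝ (Fin d)

/-! ### The Sobolev space `[H¹₀(Ω)]^d` -/

/-- Vector fields in `[C_c^∞(Ω)]^d`. -/
structure IsTestField {d : ℕ} (Ω : Set (Space d)) (φ : Space d → Space d) : Prop where
  smooth : ContDiff ℝ ∞ φ
  compact : HasCompactSupport φ
  support : tsupport φ ⊆ Ω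

/-- `u ∈ [H¹₀(Ω)]^d`, the closure of `[C_c^∞(Ω)]^d` in the `H¹` norm: test fields converge to `u` in
`L²(Ω)` while their gradients converge in `L²(Ω)` (the limit `g` is then the weak gradient of
`u`). -/
def MemH10 {d : ℕ} (Ω : Set (Space d)) (u : Space d → Space d) : Prop :=
  MemLp u 2 (volume.restrict Ω) ∧
  ∃ g : Space d → Space d →L[ℝ] Space d, MemLp g 2 (volume.restrict Ω) ∧
    ∃ φ : ℕ → Space d → Space d, (∀ n, IsTestField Ω (φ n)) ∧
      Tendsto (fun n => eLpNorm (φ n - u) 2 (volume.restrict Ω)) atTop (𝓝 0) ∧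
      Tendsto (fun n => eLpNorm (fderiv ℝ (φ n) - g) 2 (volume.restrict Ω)) atTop (𝓝 0)

/-! ### Simplicial meshes -/

/-- A conforming simplicial mesh of `Ω ⊆ ℝ^d`: a finite geometric simplicial complex with
underlying space the closure of `Ω`, all of whose maximal simplices are `d`-dimensional. -/
structure Triangulation {d : ℕ} (Ω : Set (Space d)) where
  complex : Geometry.SimplicialComplex ℝ (Space d)
  finite : complex.faces.Finite
  pure : ∀ s ∈ complex.faces, ∃ t ∈ complex.faces, s ⊆ t ∧ t.card = d + 1
  cover : complex.space = closure Ω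

/-- The elements `K ∈ 𝒯_h`, given by their `d + 1` vertices. -/
def Triangulation.Elem {d : ℕ} {Ω : Set (Space d)} (T : Triangulation Ω) : Type :=
  {K : Finset (Space d) // K ∈ T.complex.faces ∧ K.card = d + 1}

/-- The edges (`d = 2`) or faces (`d = 3`) `e ∈ ℰ_h`, given by their `d` vertices. -/
def Triangulation.Facet {d : ℕ} {Ω : Set (Space d)} (T : Triangulation Ω) : Type :=
  {e : Finset (Space d) // e ∈ T.complex.faces ∧ e.card = d}

instance {d : ℕ} {Ω : Set (Space d)} (T : Triangulation Ω) : Fintype T.Elem :=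
  (T.finite.subset (fun _ h => h.1) :
    {K : Finset (Space d) | K ∈ T.complex.faces ∧ K.card = d + 1}.Finite).fintype

instance {d : ℕ} {Ω : Set (Space d)} (T : Triangulation Ω) : Fintype T.Facet :=
  (T.finite.subset (fun _ h => h.1) :
    {e : Finset (Space d) | e ∈ T.complex.faces ∧ e.card = d}.Finite).fintype

/-- A mesh together with the choice, for every facet `e`, of the neighbouring element `K⁺`. The
unit normal `n_e` points out of `K⁺`. -/
structure Mesh {d : ℕ} (Ω : Set (Space d)) extends Triangulation Ω where
  plus : toTriangulation.Facet → toTriangulation.Elem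
  plus_spec : ∀ e, e.1 ⊆ (plus e).1

namespace Mesh

variable {d : ℕ} {Ω : Set (Space d)} (M : Mesh Ω)

/-- The elements of the mesh. -/
abbrev Elem : Type := M.toTriangulation.Elem

/-- The facets of the mesh. -/
abbrev Facet : Type := M.toTriangulation.Facet

/-- The closed simplex `K`. -/
def cell (K : M.Elem) : Set (Space d) := convexHull ℝ (K.1 : Set (Space d))

/-- The closed edge/face `e`. -/
def face (e : M.Facet) : Set (Space d) := convexHull ℝ (e.1 : Set (Space d))

/-- `h_K ≤ σ r` for some ball of radius `r` inside `K`, for every element `K`. -/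
def ShapeRegular (σ : ℝ) : Prop :=
  ∀ K : M.Elem, ∃ (x : Space d) (r : ℝ), 0 < r ∧ Metric.closedBall x r ⊆ M.cell K ∧
    Metric.diam (M.cell K) ≤ σ * r

/-- The facet is shared by a second element; otherwise it is a boundary facet. -/
def IsInterior (e : M.Facet) : Prop := ∃ K : M.Elem, K ≠ M.plus e ∧ e.1 ⊆ K.1

open Classical in
/-- The element `K⁻` on the other side of an interior facet (on a boundary facet the value is
irrelevant). -/
def minus (e : M.Facet) : M.Elem := if h : M.IsInterior e then h.choose else M.plus e

/-- `n` is the unit normal of the facet `e` pointing out of the element `K ⊇ e`. -/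
def IsOuterNormal (K : M.Elem) (e : M.Facet) (n : Space d) : Prop :=
  ‖n‖ = 1 ∧ (∀ x ∈ e.1, ∀ y ∈ e.1, inner ℝ n (x - y) = 0) ∧
    ∀ x ∈ e.1, ∀ z ∈ K.1, z ∉ e.1 → inner ℝ n (z - x) < 0

/-- The unit normal `n_e`, pointing from `K⁺` to `K⁻`, or out of `Ω` on a boundary facet. -/
def normal (e : M.Facet) : Space d := Classical.epsilon (M.IsOuterNormal (M.plus e) e)

/-- `∫_e g ds`, with the `(d-1)`-dimensional surface measure. -/
def faceIntegral (e : M.Facet) (g : Space d → ℝ) : ℝ :=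
  ∫ x in M.face e, g x ∂(μHE[d - 1] : Measure (Space d))

/-- The length/area `|e|`. -/
def faceMeasure (e : M.Facet) : ℝ := (μHE[d - 1] : Measure (Space d)).real (M.face e)

/-- `h_e = |e|^{1/(d-1)}`. -/
def faceSize (e : M.Facet) : ℝ := M.faceMeasure e ^ (1 / ((d : ℝ) - 1))

/-! ### Piecewise polynomials -/

/-- Piecewise `[ℙ₁]^d` vector fields: one affine field for each element. The trace of `v|_K` on a
facet of `K` is the restriction of `v K`. -/
abbrev BrokenP1 : Type := M.Elem → (Space d →ᵃ[ℝ] Space d)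

open Classical in
/-- The function, defined almost everywhere on `Ω`, that is equal to `g K` inside each element. -/
def glue {X : Type} [AddCommMonoid X] (g : M.Elem → Space d → X) (x : Space d) : X :=
  ∑ K : M.Elem, if x ∈ interior (M.cell K) then g K x else 0

/-- The piecewise affine vector field, as a function on `Ω`. -/
def field (v : M.BrokenP1) : Space d → Space d := M.glue fun K => v K

open Classical in
/-- The jump `⟦g⟧` on the facet `e` of a piecewise defined function. -/
def jump {X : Type} [AddCommGroup X] (g : M.Elem → Space d → X) (e : M.Facet) (x : Space d) : X :=
  if M.IsInterior e then g (M.plus e) x - g (M.minus e) x else g (M.plus e) x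

open Classical in
/-- The average `{g}` on the facet `e` of a piecewise defined function. -/
def avg {X : Type} [AddCommGroup X] [Module ℝ X] (g : M.Elem → Space d → X) (e : M.Facet)
    (x : Space d) : X :=
  if M.IsInterior e then (1 / 2 : ℝ) • (g (M.plus e) x + g (M.minus e) x) else g (M.plus e) x

/-! ### The finite element spaces -/

theorem field_zero : M.field 0 = 0 := by
  funext x; simp [field, glue]

theorem field_add (v w : M.BrokenP1) : M.field (v + w) = M.field v + M.field w := by
  funext x
  simp only [field, glue, Pi.add_apply, AffineMap.coe_add, ← Finset.sum_add_distrib]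
  refine Finset.sum_congr rfl fun K _ => ?_
  split_ifs <;> simp

theorem field_smul (c : ℝ) (v : M.BrokenP1) : M.field (c • v) = c • M.field v := by
  funext x
  simp only [field, glue, Pi.smul_apply, AffineMap.coe_smul, Finset.smul_sum]
  refine Finset.sum_congr rfl fun K _ => ?_
  split_ifs <;> simp

theorem memLp_zero_aux {X : Type} [NormedAddCommGroup X] {μ : Measure (Space d)} :
    MemLp (0 : Space d → X) 2 μ := MemLp.zero

theorem eLpNorm_zero_aux {X : Type} [NormedAddCommGroup X] {μ : Measure (Space d)} :
    Tendsto (fun _ : ℕ => eLpNorm (0 - 0 : Space d → X) 2 μ) atTop (𝓝 0) := by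
  simp

theorem memLp_add_aux {X : Type} [NormedAddCommGroup X] {μ : Measure (Space d)}
    {g k : Space d → X} (hg : MemLp g 2 μ) (hk : MemLp k 2 μ) : MemLp (g + k) 2 μ := hg.add hk

theorem memH10_zero : MemH10 Ω (0 : Space d → Space d) := by
  refine ⟨memLp_zero_aux, 0, memLp_zero_aux, fun _ => 0,
    fun _ => ⟨contDiff_const, .zero, ?_⟩, eLpNorm_zero_aux, ?_⟩
  · simp [tsupport]
  · have : fderiv ℝ (0 : Space d → Space d) = 0 := by funext x; simp
    simp only [this]
    exact eLpNorm_zero_aux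

theorem eLpNorm_tendsto_add {X : Type} [NormedAddCommGroup X] {μ : Measure (Space d)}
    {F G : ℕ → Space d → X} {u w : Space d → X}
    (hF : ∀ n, AEStronglyMeasurable (F n) μ) (hG : ∀ n, AEStronglyMeasurable (G n) μ)
    (hu : AEStronglyMeasurable u μ) (hw : AEStronglyMeasurable w μ)
    (h1 : Tendsto (fun n => eLpNorm (F n - u) 2 μ) atTop (𝓝 0))
    (h2 : Tendsto (fun n => eLpNorm (G n - w) 2 μ) atTop (𝓝 0)) :
    Tendsto (fun n => eLpNorm (F n + G n - (u + w)) 2 μ) atTop (𝓝 0) := by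
  refine tendsto_of_tendsto_of_tendsto_of_le_of_le tendsto_const_nhds
    (by simpa using h1.add h2) (fun _ => zero_le) fun n => ?_
  simp only [add_sub_add_comm]
  exact eLpNorm_add_le ((hF n).sub hu) ((hG n).sub hw) (by norm_num)

theorem eLpNorm_tendsto_smul {X : Type} [NormedAddCommGroup X] [NormedSpace ℝ X]
    {μ : Measure (Space d)} {F : ℕ → Space d → X} {u : Space d → X} (c : ℝ)
    (h : Tendsto (fun n => eLpNorm (F n - u) 2 μ) atTop (𝓝 0)) :
    Tendsto (fun n => eLpNorm (c • F n - c • u) 2 μ) atTop (𝓝 0) := by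
  simp only [← smul_sub, eLpNorm_const_smul]
  simpa using ENNReal.Tendsto.const_mul h (Or.inr (by simp))

theorem memH10_add {u w : Space d → Space d} (hu : MemH10 Ω u) (hw : MemH10 Ω w) :
    MemH10 Ω (u + w) := by
  obtain ⟨hu, g, hg, φ, hφ, h1, h2⟩ := hu
  obtain ⟨hw, k, hk, ψ, hψ, h3, h4⟩ := hw
  have hd : ∀ n, fderiv ℝ (φ n + ψ n) = fderiv ℝ (φ n) + fderiv ℝ (ψ n) := fun n => by
    funext x
    exact fderiv_add ((hφ n).smooth.differentiable (by simp) x)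
      ((hψ n).smooth.differentiable (by simp) x)
  refine ⟨hu.add hw, g + k, memLp_add_aux hg hk, fun n => φ n + ψ n, fun n => ⟨?_, ?_, ?_⟩, ?_, ?_⟩
  · exact (hφ n).smooth.add (hψ n).smooth
  · exact (hφ n).compact.add (hψ n).compact
  · exact (tsupport_add _ _).trans (Set.union_subset (hφ n).support (hψ n).support)
  · exact eLpNorm_tendsto_add (fun n => (hφ n).smooth.continuous.aestronglyMeasurable)
      (fun n => (hψ n).smooth.continuous.aestronglyMeasurable) hu.1 hw.1 h1 h3
  · simp only [hd]
    exact eLpNorm_tendsto_add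
      (fun n => ((hφ n).smooth.continuous_fderiv (by simp)).aestronglyMeasurable)
      (fun n => ((hψ n).smooth.continuous_fderiv (by simp)).aestronglyMeasurable) hg.1 hk.1 h2 h4

theorem memH10_smul (c : ℝ) {u : Space d → Space d} (hu : MemH10 Ω u) : MemH10 Ω (c • u) := by
  obtain ⟨hu, g, hg, φ, hφ, h1, h2⟩ := hu
  have hd : ∀ n, fderiv ℝ (c • φ n) = c • fderiv ℝ (φ n) := fun n => by
    funext x
    exact fderiv_const_smul ((hφ n).smooth.differentiable (by simp) x) c
  refine ⟨hu.const_smul c, c • g, hg.const_smul c, fun n => c • φ n, fun n => ⟨?_, ?_, ?_⟩, ?_, ?_⟩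
  · exact contDiff_const.smul (hφ n).smooth
  · exact (hφ n).compact.smul_left (f := fun _ => c)
  · exact (closure_mono (Function.support_const_smul_subset c (φ n))).trans (hφ n).support
  · exact eLpNorm_tendsto_smul c h1
  · simp only [hd]
    exact eLpNorm_tendsto_smul c h2

/-- `C_h`: the piecewise affine fields in `[H¹₀(Ω)]^d`. -/
def spaceC : Submodule ℝ M.BrokenP1 where
  carrier := {v | MemH10 Ω (M.field v)}
  zero_mem' := by
    simp only [Set.mem_ofPred_eq, field_zero]
    exact memH10_zero
  add_mem' := fun {v w} hv hw => by
    simp only [Set.mem_ofPred_eq, field_add] at hv hw ⊢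
    exact memH10_add hv hw
  smul_mem' := fun c v hv => by
    simp only [Set.mem_ofPred_eq, field_smul] at hv ⊢
    exact memH10_smul c hv

/-- The centroid `x_K`. -/
def centroid (K : M.Elem) : Space d := K.1.centroid ℝ id

/-- `D_h`: the fields equal to `c_K (x - x_K)` on each element `K`. -/
def spaceD : Submodule ℝ M.BrokenP1 where
  carrier := {v | ∃ c : M.Elem → ℝ, ∀ K x, v K x = c K • (x - M.centroid K)}
  zero_mem' := ⟨0, by simp⟩
  add_mem' := by
    rintro v w ⟨a, ha⟩ ⟨b, hb⟩
    exact ⟨a + b, fun K x => by simp [ha, hb, add_smul]⟩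
  smul_mem' := by
    rintro c v ⟨a, ha⟩
    exact ⟨c • a, fun K x => by simp [ha, mul_smul]⟩

/-- The velocity space `V_h = C_h ⊕ D_h`. -/
def velocity : Submodule ℝ M.BrokenP1 := M.spaceC ⊔ M.spaceD

/-- Piecewise constants. -/
abbrev BrokenP0 : Type := M.Elem → ℝ

/-- The pressure space `Q_h`: piecewise constants `q` with `(q, 1) = 0`. -/
def pressure : Submodule ℝ M.BrokenP0 where
  carrier := {q | ∑ K, ∫ _ in M.cell K, q K = 0}
  zero_mem' := by simp
  add_mem' := fun {p q} hp hq => by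
    simp only [Set.mem_ofPred_eq, integral_const, smul_eq_mul, Pi.add_apply, mul_add,
      Finset.sum_add_distrib] at hp hq ⊢
    rw [hp, hq, add_zero]
  smul_mem' := fun c q hq => by
    simp only [Set.mem_ofPred_eq, integral_const, smul_eq_mul, Pi.smul_apply, mul_left_comm _ c,
      ← Finset.mul_sum] at hq ⊢
    rw [hq, mul_zero]

/-! ### The forms, the mesh-dependent norm and the velocity reconstruction -/

/-- The squared Frobenius norm of a gradient. -/
def frobSq (L : Space d →ₗ[ℝ] Space d) : ℝ := ∑ i, ‖L (EuclideanSpace.single i 1)‖ ^ 2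

/-- The mesh-dependent norm
`(‖∇v‖²_{0,𝒯_h} + ρ ‖h_e^{-1/2} ⟦v⟧‖²_{0,ℰ_h})^{1/2}`. The gradient of `v` on `K` is the linear part
of `v K`. -/
def energyNorm (ρ : ℝ) (v : M.BrokenP1) : ℝ :=
  Real.sqrt ((∑ K, ∫ _ in M.cell K, frobSq (v K).linear) +
    ρ * ∑ e, M.faceIntegral e fun x => (M.faceSize e)⁻¹ * ‖M.jump (fun K => v K) e x‖ ^ 2)

/-- `b(w, q) = (∇·w, q)_{𝒯_h} - ⟨⟦w⟧·n_e, {q}⟩_{ℰ_h}`. -/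
def formB (w : M.BrokenP1) (q : M.BrokenP0) : ℝ :=
  (∑ K, ∫ _ in M.cell K, LinearMap.trace ℝ (Space d) (w K).linear * q K) -
    ∑ e, M.faceIntegral e fun x =>
      inner ℝ (M.jump (fun K => w K) e x) (M.normal e) * M.avg (fun K _ => q K) e x

/-- The Brezzi–Douglas–Marini space `BDM₁`: piecewise `[ℙ₁]^d` fields whose normal component is
continuous across every interior facet. -/
def BDM1 : Set M.BrokenP1 :=
  {w | ∀ e, M.IsInterior e → ∀ x ∈ M.face e,
    inner ℝ (w (M.plus e) x) (M.normal e) = inner ℝ (w (M.minus e) x) (M.normal e)}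

/-- `r = ℛv`: `r ∈ BDM₁`, the first normal moments of `r` on interior facets are those of `{v}`, and
those on boundary facets vanish. -/
def IsReconstruction (v r : M.BrokenP1) : Prop :=
  r ∈ M.BDM1 ∧
  (∀ e, M.IsInterior e → ∀ p : Space d →ᵃ[ℝ] ℝ,
    M.faceIntegral e (fun x => inner ℝ (r (M.plus e) x) (M.normal e) * p x) =
      M.faceIntegral e (fun x => inner ℝ (M.avg (fun K => v K) e x) (M.normal e) * p x)) ∧
  (∀ e, ¬ M.IsInterior e → ∀ p : Space d →ᵃ[ℝ] ℝ,
    M.faceIntegral e (fun x => inner ℝ (r (M.plus e) x) (M.normal e) * p x) = 0)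

/-- The velocity reconstruction operator `ℛ`. -/
def reconstruct (v : M.BrokenP1) : M.BrokenP1 := Classical.epsilon (M.IsReconstruction v)

/-- The load `(f, ℛv)`. -/
def load (f : Space d → Space d) (v : M.BrokenP1) : ℝ :=
  ∫ x in Ω, inner ℝ (f x) (M.field (M.reconstruct v) x)

/-- `(u, p) ∈ V_h × Q_h` solves the perturbed pressure-robust EG method with velocity form `aD`. -/
def IsSolution (aD : M.velocity →ₗ[ℝ] M.velocity →ₗ[ℝ] ℝ) (f : Space d → Space d)
    (u : M.velocity) (p : M.pressure) : Prop :=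
  (∀ v : M.velocity, aD u v - M.formB v p = M.load f v) ∧
  (∀ q : M.pressure, M.formB u q = 0)

end Mesh

end EG

end

/-!
On the finite-dimensional space `V_h × Q_h` the method is a square linear system, so it is enough
to show that the homogeneous problem has only the trivial solution. Testing with `u_h` and using
coercivity gives `‖u_h‖_ℰ = 0`: `u_h` is constant on every element and has no jumps. It is then
one constant on all of `Ω`, because any two elements are joined by a chain of elements sharing
facets (a generic segment between two points of `Ω` avoids the faces of codimension two), and this
constant is zero, because the mesh has a boundary facet. The pressure is now orthogonal to the
divergences of the enrichment functions `φ_K = (x - x_K) 1_K`. By the identity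
`|e| n_e · (x - x_K) = |K| d / (d + 1)` for `x` on a facet `e` of `K`, with `n_e` pointing out of
`K`, the number `b(φ_K, p_h)` is a positive multiple of the sum of `p_h|_K - {p_h}_e` over the
facets `e` of `K`. Therefore, where `p_h` is maximal it agrees with its value on all neighbours,
so that it is constant and, having mean zero, it vanishes.

The normal components of an affine field on the facets of `K` that meet at a vertex `z` determine,
and can be prescribed by, the value of the field at `z`, since the `d` normals of these facets are
linearly independent. This gives the reconstruction: the moment conditions fix the normal
component on every facet.
-/

namespace EG

section AffineBasis

variable {ι k V P W : Type*} [AddCommGroup V] [AddTorsor V P]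

theorem existsUnique_affineMap_apply_eq [CommRing k] [Module k V] [AddCommGroup W] [Module k W]
    [Finite ι] (b : AffineBasis ι k P) (c : ι → W) : ∃! f : P →ᵃ[k] W, ∀ i, f (b i) = c i := by
  classical
  have := Fintype.ofFinite ι
  refine ⟨(Fintype.linearCombination k c).toAffineMap.comp b.coords, fun i => ?_, fun f hf => ?_⟩
  · simp [Fintype.linearCombination_apply, b.coord_apply]
  · refine AffineMap.ext_on b.tot ?_
    rintro _ ⟨i, rfl⟩
    simp [hf, Fintype.linearCombination_apply, b.coord_apply]

theorem existsUnique_coord_linear_eq [Field k] [Module k V] [Finite ι] (b : AffineBasis ι k P)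
    (i : ι) (c : {j // j ≠ i} → k) : ∃! v : V, ∀ j, (b.coord j.1).linear v = c j := by
  classical
  have hrepr (j : {j // j ≠ i}) : (b.coord j.1).linear = (b.basisOf i).coord j := by
    refine (b.basisOf i).ext fun l => ?_
    rw [b.basisOf_apply, AffineMap.linearMap_vsub, Module.Basis.coord_apply,
      ← b.basisOf_apply, Module.Basis.repr_self, b.coord_apply, b.coord_apply, if_neg j.2]
    simp [Finsupp.single_apply, Subtype.ext_iff, eq_comm]
  simp only [hrepr]
  simpa [funext_iff] using (b.basisOf i).equivFun.bijective.existsUnique c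

end AffineBasis

section InnerProductSpace

variable {E : Type*} [NormedAddCommGroup E] [InnerProductSpace ℝ E]

theorem inner_eq_of_mem_convexHull {s : Set E} {n : E} {c : ℝ} (h : ∀ y ∈ s, inner ℝ n y = c)
    {x : E} (hx : x ∈ convexHull ℝ s) : inner ℝ n x = c :=
  AffineMap.eqOn_affineSpan (f := (innerₛₗ ℝ n).toAffineMap) (g := AffineMap.const ℝ E c) h
    (convexHull_subset_affineSpan s hx)

theorem mem_mk'_orthogonal_span_singleton_iff {n : E} (hn : ‖n‖ = 1) {s : ℝ} {x z : E} :
    x ∈ AffineSubspace.mk' (s • n +ᵥ z) (ℝ ∙ n)ᗮ ↔ inner ℝ n (x - z) = s := by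
  rw [AffineSubspace.mem_mk', Submodule.mem_orthogonal_singleton_iff_inner_right, vsub_eq_sub,
    vadd_eq_add, sub_add_eq_sub_sub_swap, inner_sub_right, inner_smul_right,
    real_inner_self_eq_norm_sq, hn, one_pow, mul_one, sub_eq_zero]

section Cone

variable {A : Set E} {z n : E} {h s : ℝ}

theorem convexJoin_singleton_inter_hyperplane (hn : ‖n‖ = 1) (hh : 0 < h)
    (hA : ∀ y ∈ A, inner ℝ n (y - z) = h) (hs : s ∈ Set.Icc 0 h) :
    convexJoin ℝ {z} A ∩ AffineSubspace.mk' (s • n +ᵥ z) (ℝ ∙ n)ᗮ =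
      AffineMap.homothety z (s / h) '' A := by
  ext x
  rw [Set.mem_inter_iff, SetLike.mem_coe, mem_mk'_orthogonal_span_singleton_iff hn]
  simp only [mem_convexJoin, Set.mem_singleton_iff, exists_eq_left, Set.mem_image,
    segment_eq_image', AffineMap.homothety_apply, vsub_eq_sub, vadd_eq_add]
  constructor
  · rintro ⟨⟨y, hy, t, -, rfl⟩, hxs⟩
    rw [add_sub_cancel_left, inner_smul_right, hA y hy] at hxs
    exact ⟨y, hy, by rw [← hxs, mul_div_cancel_right₀ t hh.ne', add_comm]⟩
  · rintro ⟨y, hy, rfl⟩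
    refine ⟨⟨y, hy, s / h, ⟨div_nonneg hs.1 hh.le, (div_le_one hh).2 hs.2⟩, add_comm _ _⟩, ?_⟩
    rw [add_sub_cancel_right, inner_smul_right, hA y hy, div_mul_cancel₀ s hh.ne']

theorem convexJoin_singleton_inter_hyperplane_eq_empty (hn : ‖n‖ = 1) (hh : 0 ≤ h)
    (hA : ∀ y ∈ A, inner ℝ n (y - z) = h) (hs : s ∉ Set.Icc 0 h) :
    convexJoin ℝ {z} A ∩ AffineSubspace.mk' (s • n +ᵥ z) (ℝ ∙ n)ᗮ = ∅ := by
  refine Set.eq_empty_of_forall_notMem fun x ⟨hx, hxs⟩ => hs ?_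
  rw [SetLike.mem_coe, mem_mk'_orthogonal_span_singleton_iff hn] at hxs
  simp only [mem_convexJoin, Set.mem_singleton_iff, exists_eq_left, segment_eq_image'] at hx
  obtain ⟨y, hy, t, ⟨ht₀, ht₁⟩, rfl⟩ := hx
  rw [add_sub_cancel_left, inner_smul_right, hA y hy] at hxs
  rw [← hxs]
  exact ⟨mul_nonneg ht₀ hh, mul_le_of_le_one_left hh ht₁⟩

theorem lintegral_Ioc_div_pow {h : ℝ} (hh : 0 < h) (m : ℕ) :
    ∫⁻ s in Set.Ioc 0 h, ENNReal.ofReal ((s / h) ^ m) = ENNReal.ofReal (h / (m + 1)) := by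
  rw [← ofReal_integral_eq_lintegral_ofReal
    ((Continuous.integrableOn_Icc (by fun_prop)).mono_set Set.Ioc_subset_Icc_self),
    ← intervalIntegral.integral_of_le hh.le]
  · simp only [div_pow, intervalIntegral.integral_div, integral_pow]
    congr 1
    field_simp
    simp [pow_succ]
  · filter_upwards [ae_restrict_mem measurableSet_Ioc] with s hs
    exact pow_nonneg (div_nonneg hs.1.le hh.le) m

theorem volume_convexJoin_singleton [FiniteDimensional ℝ E] [MeasurableSpace E] [BorelSpace E]
    (hn : ‖n‖ = 1) (hh : 0 < h) (hA : ∀ y ∈ A, inner ℝ n (y - z) = h)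
    (hmeas : MeasurableSet (convexJoin ℝ {z} A)) :
    volume (convexJoin ℝ {z} A) = ENNReal.ofReal (h / Module.finrank ℝ E) *
      (μHE[Module.finrank ℝ E - 1] : Measure E) A := by
  have hn₀ : n ≠ 0 := norm_ne_zero_iff.1 (by simp [hn])
  have : Nontrivial E := ⟨n, 0, hn₀⟩
  have hdim : ((Module.finrank ℝ E - 1 : ℕ) : ℝ) + 1 = Module.finrank ℝ E := by
    exact_mod_cast Nat.sub_add_cancel Module.finrank_pos
  set m := Module.finrank ℝ E - 1
  let slice (s : ℝ) : Set E :=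
    convexJoin ℝ {z} A ∩ AffineSubspace.mk' (s • n +ᵥ z) (ℝ ∙ n)ᗮ
  have hslice (s : ℝ) (hs : s ∈ Set.Ioc 0 h) :
      μHE[m] (slice s) = ENNReal.ofReal ((s / h) ^ m) * μHE[m] A := by
    have hsh : 0 < s / h := div_pos hs.1 hh
    have hhom : slice s = AffineMap.homothety z (s / h) '' A :=
      convexJoin_singleton_inter_hyperplane hn hh hA (Set.Ioc_subset_Icc_self hs)
    rw [hhom, euclideanHausdorffMeasure_homothety_image _ _ hsh.ne', ENNReal.smul_def, smul_eq_mul,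
      ENNReal.ofReal_pow hsh.le, ENNReal.coe_pow, ← Real.enorm_of_nonneg hsh.le]
    rfl
  have hempty : (Function.support fun s => (μHE[m] : Measure E) (slice s)) ⊆ Set.Icc 0 h := by
    refine Function.support_subset_iff'.2 fun s hs => ?_
    have hslice₀ : slice s = ∅ := convexJoin_singleton_inter_hyperplane_eq_empty hn hh.le hA hs
    rw [hslice₀, measure_empty]
  calc volume (convexJoin ℝ {z} A)
      = ∫⁻ s, μHE[m] (slice s) := by
        rw [← InnerProductSpace.euclideanHausdorffMeasure_eq_volume,
          EuclideanGeometry.euclideanHausdorffMeasure_eq_lintegral z hn₀ hmeas,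
          ← ofReal_norm, hn, ENNReal.ofReal_one, one_mul]
    _ = ∫⁻ s in Set.Ioc 0 h, μHE[m] (slice s) := by
        rw [setLIntegral_congr Ioc_ae_eq_Icc, ← lintegral_indicator measurableSet_Icc,
          Set.indicator_eq_self.2 hempty]
    _ = ∫⁻ s in Set.Ioc 0 h, ENNReal.ofReal ((s / h) ^ m) * μHE[m] A :=
        setLIntegral_congr_fun measurableSet_Ioc hslice
    _ = ENNReal.ofReal (h / Module.finrank ℝ E) * μHE[m] A := by
        rw [lintegral_mul_const _ (by fun_prop), lintegral_Ioc_div_pow hh, hdim]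

end Cone

end InnerProductSpace

section NormedSpace

variable {E : Type*} [NormedAddCommGroup E] [NormedSpace ℝ E]

/-- A small homothety centred at a point of `U ∩ s` maps `s` into `U ∩ s`. -/
theorem euclideanHausdorffMeasure_inter_pos [MeasurableSpace E] [BorelSpace E] {k : ℕ}
    {s U : Set E} (hs : Convex ℝ s) (hbdd : Bornology.IsBounded s)
    (hpos : (μHE[k] : Measure E) s ≠ 0) (hU : IsOpen U) (hne : (U ∩ s).Nonempty) :
    0 < (μHE[k] : Measure E) (U ∩ s) := by
  obtain ⟨x, hxU, hxs⟩ := hne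
  obtain ⟨R, hR⟩ := (Metric.isBounded_iff_subset_closedBall x).1 hbdd
  have hlim : Tendsto (fun c : ℝ => c * R) (𝓝[>] 0) (𝓝 0) := by
    simpa using ((continuous_mul_const R).tendsto 0).mono_left nhdsWithin_le_nhds
  obtain ⟨r, hr, hball⟩ := Metric.isOpen_iff.1 hU x hxU
  obtain ⟨c, hcR, hc₀, hc₁⟩ :=
    ((hlim.eventually_lt_const hr).and (Ioo_mem_nhdsGT one_pos)).exists
  have hsub : AffineMap.homothety x c '' s ⊆ U ∩ s := by
    rintro _ ⟨y, hy, rfl⟩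
    refine ⟨hball ?_, hs.segment_subset hxs hy ?_⟩
    · rw [Metric.mem_ball, dist_homothety_center, Real.norm_of_nonneg hc₀.le, dist_comm]
      exact (mul_le_mul_of_nonneg_left (hR hy) hc₀.le).trans_lt hcR
    · rw [segment_eq_image_lineMap]
      exact ⟨c, ⟨hc₀.le, hc₁.le⟩, rfl⟩
  refine lt_of_lt_of_le ?_ (measure_mono hsub)
  rw [euclideanHausdorffMeasure_homothety_image _ _ hc₀.ne', ENNReal.smul_def, smul_eq_mul]
  exact ENNReal.mul_pos (by simp [hc₀.ne']) hpos

theorem eqOn_zero_of_setIntegral_eq_zero {X : Type*} [TopologicalSpace X] [MeasurableSpace X]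
    [BorelSpace X] {μ : Measure X} {s : Set X}
    (hpos : ∀ U, IsOpen U → (U ∩ s).Nonempty → 0 < μ (U ∩ s)) {f : X → ℝ} (hf : Continuous f)
    (hnonneg : 0 ≤ f) (hint : IntegrableOn f s μ) (h : ∫ x in s, f x ∂μ = 0) :
    s.EqOn f 0 := by
  intro x hx
  by_contra hne
  have hopen : IsOpen {y | f y ≠ 0} := isOpen_ne_fun hf continuous_const
  refine (hpos _ hopen ⟨x, hne, hx⟩).ne' ?_
  rw [← Measure.restrict_apply hopen.measurableSet]
  exact ae_iff.1 ((integral_eq_zero_iff_of_nonneg hnonneg hint).1 h)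

theorem affineSpan_finset_ne_top {t : Finset E} (ht : t.card ≤ Module.finrank ℝ E) :
    affineSpan ℝ (t : Set E) ≠ ⊤ := by
  classical
  intro htop
  rcases t.eq_empty_or_nonempty with rfl | hne
  · rw [Finset.coe_empty, AffineSubspace.span_empty] at htop
    exact bot_ne_top htop
  have hle := finrank_vectorSpan_image_finset_le ℝ (id : E → E) t
    (Nat.sub_add_cancel hne.card_pos).symm
  rw [Finset.image_id, ← direction_affineSpan, htop, AffineSubspace.direction_top,
    finrank_top] at hle
  have := hne.card_pos
  omega

variable [FiniteDimensional ℝ E] {F : Set (Finset E)}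

theorem exists_mem_forall_notMem_affineSpan {U : Set E} (hU : IsOpen U) (hne : U.Nonempty)
    (hF : F.Finite) (hcard : ∀ s ∈ F, s.card ≤ Module.finrank ℝ E) :
    ∃ a ∈ U, ∀ s ∈ F, a ∉ affineSpan ℝ (s : Set E) := by
  borelize E
  by_contra! hcover
  refine (hU.measure_pos Measure.addHaar hne).ne' (measure_mono_null
    (t := ⋃ s ∈ F, (affineSpan ℝ (s : Set E) : Set E)) (fun a ha => ?_) ?_)
  · obtain ⟨s, hs, has⟩ := hcover a ha
    exact Set.mem_biUnion hs has
  · exact (measure_biUnion_null_iff hF.countable).2 fun s hs =>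
      Measure.addHaar_affineSubspace _ _ (affineSpan_finset_ne_top (hcard s hs))

/-- Choose `a` off the given spans, then `b` off the joins of these spans with `a`. -/
theorem exists_segment_disjoint_affineSpan {A B : Set E} (hA : IsOpen A) (hAne : A.Nonempty)
    (hB : IsOpen B) (hBne : B.Nonempty) (hF : F.Finite)
    (hcard : ∀ s ∈ F, s.card < Module.finrank ℝ E) :
    ∃ a ∈ A, ∃ b ∈ B, ∀ y ∈ segment ℝ a b, ∀ s ∈ F, y ∉ affineSpan ℝ (s : Set E) := by
  classical
  obtain ⟨a, haA, ha⟩ :=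
    exists_mem_forall_notMem_affineSpan hA hAne hF fun s hs => (hcard s hs).le
  obtain ⟨b, hbB, hb⟩ := exists_mem_forall_notMem_affineSpan hB hBne (hF.image (insert a)) (by
    rintro _ ⟨s, hs, rfl⟩
    exact (Finset.card_insert_le a s).trans (hcard s hs))
  refine ⟨a, haA, b, hbB, fun y hy s hs hys => ?_⟩
  rw [segment_eq_image_lineMap] at hy
  obtain ⟨t, -, rfl⟩ := hy
  have ht : t ≠ 0 := by
    rintro rfl
    exact ha s hs (by simpa using hys)
  refine hb _ ⟨s, hs, rfl⟩ ?_
  have hb_eq : AffineMap.lineMap a (AffineMap.lineMap a b t) t⁻¹ = b := by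
    simp [AffineMap.lineMap_apply, smul_smul, inv_mul_cancel₀ ht]
  rw [← hb_eq, Finset.coe_insert]
  exact AffineMap.lineMap_mem _ (subset_affineSpan ℝ _ (Set.mem_insert a _))
    (affineSpan_mono ℝ (Set.subset_insert a _) hys)

end NormedSpace

section SimpleGraph

variable {α : Type*} {G : SimpleGraph α}

theorem forall_of_preconnected (hG : G.Preconnected) {p : α → Prop} {a : α} (ha : p a)
    (h : ∀ u v, G.Adj u v → p u → p v) (b : α) : p b := by
  obtain ⟨w⟩ := hG a b
  induction w with
  | nil => exact ha
  | cons hadj _ ih => exact ih (h _ _ hadj ha)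

end SimpleGraph

section SaddlePoint

variable {𝕜 V Q : Type*} [Field 𝕜] [AddCommGroup V] [Module 𝕜 V] [FiniteDimensional 𝕜 V]
  [AddCommGroup Q] [Module 𝕜 Q] [FiniteDimensional 𝕜 Q]

theorem existsUnique_saddlePoint (a : V →ₗ[𝕜] V →ₗ[𝕜] 𝕜) (b : V →ₗ[𝕜] Q →ₗ[𝕜] 𝕜)
    (h : ∀ u p, (∀ v, a u v - b v p = 0) → (∀ q, b u q = 0) → u = 0 ∧ p = 0) (l : V →ₗ[𝕜] 𝕜) :
    ∃! s : V × Q, (∀ v, a s.1 v - b v s.2 = l v) ∧ ∀ q, b s.1 q = 0 := by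
  let Φ : V × Q →ₗ[𝕜] Module.Dual 𝕜 V × Module.Dual 𝕜 Q :=
    (a.coprod (-b.flip)).prod (b ∘ₗ LinearMap.fst 𝕜 V Q)
  have hΦ (s : V × Q) (m : Module.Dual 𝕜 V) : Φ s = (m, 0) ↔
      (∀ v, a s.1 v - b v s.2 = m v) ∧ ∀ q, b s.1 q = 0 := by
    simp [Φ, Prod.ext_iff, LinearMap.ext_iff, sub_eq_add_neg]
  have hinj : Function.Injective Φ := (injective_iff_map_eq_zero Φ).2 fun s hs =>
    have hs₀ := (hΦ s 0).1 hs
    Prod.ext_iff.2 (h s.1 s.2 hs₀.1 hs₀.2)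
  have hdim : Module.finrank 𝕜 (V × Q) =
      Module.finrank 𝕜 (Module.Dual 𝕜 V × Module.Dual 𝕜 Q) := by
    simp only [Module.finrank_prod, Subspace.dual_finrank_eq]
  have hsurj := (LinearMap.injective_iff_surjective_of_finrank_eq_finrank hdim).1 hinj
  obtain ⟨s, hs⟩ := hsurj (l, 0)
  exact ⟨s, (hΦ s l).1 hs, fun t ht => hinj (((hΦ t l).2 ht).trans hs.symm)⟩

end SaddlePoint

noncomputable section

namespace Mesh

variable {d : ℕ} {Ω : Set (Space d)} (M : Mesh Ω)

/-! ### Elements and their facets -/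

/-- The vertices of an element as an affine basis, whose coordinates are the barycentric
coordinates of the element. -/
def basis (K : M.Elem) : AffineBasis K.1 ℝ (Space d) where
  toFun := Subtype.val
  ind' := M.complex.indep K.2.1
  tot' := by
    rw [(M.complex.indep K.2.1).affineSpan_eq_top_iff_card_eq_finrank_add_one]
    simp [K.2.2]

@[simp]
theorem basis_apply (K : M.Elem) (z : K.1) : M.basis K z = z := rfl

theorem range_basis (K : M.Elem) : Set.range (M.basis K) = (K.1 : Set (Space d)) :=
  Subtype.range_coe

theorem coord_self (K : M.Elem) (z : K.1) : (M.basis K).coord z z = 1 :=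
  (M.basis K).coord_apply_eq z

theorem mem_cell_iff {K : M.Elem} {x : Space d} :
    x ∈ M.cell K ↔ ∀ z, 0 ≤ (M.basis K).coord z x := by
  rw [cell, ← M.range_basis K, AffineBasis.convexHull_eq_nonneg_coord, Set.mem_ofPred_eq]

theorem convex_cell (K : M.Elem) : Convex ℝ (M.cell K) := convex_convexHull ℝ _

theorem isCompact_cell (K : M.Elem) : IsCompact (M.cell K) :=
  K.1.finite_toSet.isCompact_convexHull ℝ

theorem isCompact_face (e : M.Facet) : IsCompact (M.face e) :=
  e.1.finite_toSet.isCompact_convexHull ℝ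

theorem interior_cell_nonempty (K : M.Elem) : (interior (M.cell K)).Nonempty := by
  have : Nonempty K.1 := Fintype.card_pos_iff.1 (by simp [K.2.2])
  have hcentroid := (M.basis K).centroid_mem_interior_convexHull
  rw [M.range_basis K] at hcentroid
  exact ⟨_, hcentroid⟩

theorem volume_cell_pos (K : M.Elem) : 0 < volume (M.cell K) :=
  Measure.measure_pos_of_nonempty_interior _ (M.interior_cell_nonempty K)

theorem volumeReal_cell_pos (K : M.Elem) : 0 < volume.real (M.cell K) :=
  ENNReal.toReal_pos (M.volume_cell_pos K).ne' (M.isCompact_cell K).measure_lt_top.ne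

theorem facet_nonempty (e : M.Facet) : e.1.Nonempty :=
  M.complex.nonempty_of_mem_faces e.2.1

theorem subset_face (e : M.Facet) : (e.1 : Set (Space d)) ⊆ M.face e := subset_convexHull ℝ _

theorem face_nonempty (e : M.Facet) : (M.face e).Nonempty :=
  (M.facet_nonempty e).to_set.mono (M.subset_face e)

variable {M} in
theorem IsOuterNormal.inner_eq {K : M.Elem} {e : M.Facet} {n : Space d}
    (hn : M.IsOuterNormal K e n) {x y : Space d} (hx : x ∈ M.face e) (hy : y ∈ M.face e) :
    inner ℝ n x = inner ℝ n y := by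
  obtain ⟨w, hw⟩ := M.facet_nonempty e
  have hconst (v) (hv : v ∈ (e.1 : Set (Space d))) : inner ℝ n v = inner ℝ n w :=
    sub_eq_zero.1 ((inner_sub_right _ _ _).symm.trans (hn.2.1 v hv w hw))
  rw [inner_eq_of_mem_convexHull hconst hx, inner_eq_of_mem_convexHull hconst hy]

section NeZero

variable [NeZero d]

open Classical in
/-- The facet of `K` opposite to the vertex `z`. -/
def oppFacet (K : M.Elem) (z : K.1) : M.Facet :=
  ⟨K.1.erase z, by
    have hcard : (K.1.erase z).card = d := by
      rw [Finset.card_erase_of_mem z.2, K.2.2, Nat.add_sub_cancel]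
    refine ⟨M.complex.down_closed K.2.1 (Finset.erase_subset _ _) ?_, hcard⟩
    rw [← Finset.card_pos, hcard]
    exact NeZero.pos d⟩

theorem mem_oppFacet {K : M.Elem} {z : K.1} {y : Space d} :
    y ∈ (M.oppFacet K z).1 ↔ y ≠ z ∧ y ∈ K.1 := by
  classical
  exact Finset.mem_erase

theorem oppFacet_subset (K : M.Elem) (z : K.1) : (M.oppFacet K z).1 ⊆ K.1 :=
  fun _ hy => (M.mem_oppFacet.1 hy).2

theorem oppFacet_injective (K : M.Elem) : Function.Injective (M.oppFacet K) := by
  intro z w h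
  by_contra hne
  have hz : (z : Space d) ∈ (M.oppFacet K w).1 :=
    M.mem_oppFacet.2 ⟨Subtype.coe_ne_coe.2 hne, z.2⟩
  exact (M.mem_oppFacet.1 (h ▸ hz)).1 rfl

theorem exists_eq_oppFacet {K : M.Elem} {e : M.Facet} (h : e.1 ⊆ K.1) :
    ∃ z, e = M.oppFacet K z := by
  obtain ⟨z, hz, hze⟩ := Finset.exists_mem_notMem_of_card_lt_card
    (show e.1.card < K.1.card by rw [e.2.2, K.2.2]; exact d.lt_succ_self)
  refine ⟨⟨z, hz⟩, Subtype.ext (Finset.eq_of_subset_of_card_le (fun y hy => ?_) ?_)⟩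
  · exact M.mem_oppFacet.2 ⟨fun hyz => hze (by rwa [hyz] at hy), h hy⟩
  · rw [(M.oppFacet K ⟨z, hz⟩).2.2, e.2.2]

theorem sum_eq_sum_oppFacet {X : Type*} [AddCommMonoid X] {K : M.Elem} {F : M.Facet → X}
    (hF : ∀ e, ¬ e.1 ⊆ K.1 → F e = 0) : ∑ e, F e = ∑ z, F (M.oppFacet K z) := by
  refine (Finset.sum_of_injOn (M.oppFacet K) (M.oppFacet_injective K).injOn
    (fun _ _ => Finset.mem_univ _) (fun e _ he => hF e fun hsub => he ?_) fun _ _ => rfl).symm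
  obtain ⟨z, rfl⟩ := M.exists_eq_oppFacet hsub
  exact Set.mem_image_of_mem _ (Finset.mem_univ z)

theorem cell_eq_convexJoin (K : M.Elem) (z : K.1) :
    M.cell K = convexJoin ℝ {(z : Space d)} (M.face (M.oppFacet K z)) := by
  classical
  rw [face, ← convexHull_insert (M.facet_nonempty _), cell, ← Finset.coe_insert]
  exact congrArg _ (congrArg _ (Finset.insert_erase z.2).symm)

theorem coord_eq_zero_of_mem_face {K : M.Elem} {z : K.1} {y : Space d}
    (hy : y ∈ M.face (M.oppFacet K z)) : (M.basis K).coord z y = 0 := by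
  refine AffineMap.eqOn_affineSpan (f := (M.basis K).coord z) (g := AffineMap.const ℝ _ 0)
    (fun w hw => ?_) (convexHull_subset_affineSpan _ hy)
  obtain ⟨hwz, hwK⟩ := M.mem_oppFacet.1 hw
  exact (M.basis K).coord_apply_ne (i := z) (j := ⟨w, hwK⟩) fun h => hwz (by rw [h])

theorem mem_face_oppFacet_iff {K : M.Elem} {z : K.1} {y : Space d} :
    y ∈ M.face (M.oppFacet K z) ↔ y ∈ M.cell K ∧ (M.basis K).coord z y = 0 := by
  refine ⟨fun hy => ⟨?_, M.coord_eq_zero_of_mem_face hy⟩, fun ⟨hy, hy₀⟩ => ?_⟩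
  · exact convexHull_mono (Finset.coe_subset.2 (M.oppFacet_subset K z)) hy
  · simp only [M.cell_eq_convexJoin K z, mem_convexJoin, Set.mem_singleton_iff, exists_eq_left,
      segment_eq_image_lineMap] at hy
    obtain ⟨w, hw, t, -, rfl⟩ := hy
    rw [AffineMap.apply_lineMap, M.coord_self, M.coord_eq_zero_of_mem_face hw,
      AffineMap.lineMap_apply_ring] at hy₀
    have ht : t = 1 := by linarith
    rwa [ht, AffineMap.lineMap_apply_one]

/-! ### Outer normals -/

variable {M}

section OppFacet

variable {K : M.Elem} {z : K.1} {n : Space d}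

theorem IsOuterNormal.inner_sub_pos (hn : M.IsOuterNormal K (M.oppFacet K z) n) {y : Space d}
    (hy : y ∈ M.face (M.oppFacet K z)) : 0 < inner ℝ n (y - z) := by
  obtain ⟨w, hw⟩ := M.facet_nonempty (M.oppFacet K z)
  have hneg := hn.2.2 w hw z z.2 fun h => (M.mem_oppFacet.1 h).1 rfl
  rw [inner_sub_right] at hneg ⊢
  linarith [hn.inner_eq hy (M.subset_face _ hw)]

theorem IsOuterNormal.inner_sub_eq_mul_coord (hn : M.IsOuterNormal K (M.oppFacet K z) n)
    {y : Space d} (hy : y ∈ M.face (M.oppFacet K z)) (x : Space d) :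
    inner ℝ n (y - x) = inner ℝ n (y - z) * (M.basis K).coord z x := by
  suffices h : (innerₛₗ ℝ n).toAffineMap.comp (AffineMap.const ℝ _ y - AffineMap.id ℝ _) =
      (inner ℝ n (y - z) : ℝ) • (M.basis K).coord z from DFunLike.congr_fun h x
  refine AffineMap.ext_on (M.basis K).tot ?_
  rintro _ ⟨w, rfl⟩
  change inner ℝ n (y - w) = inner ℝ n (y - z) * (M.basis K).coord z w
  rcases eq_or_ne w z with rfl | hwz
  · rw [M.coord_self, mul_one]
  · have hw : (w : Space d) ∈ M.face (M.oppFacet K z) :=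
      M.subset_face _ (M.mem_oppFacet.2 ⟨Subtype.coe_ne_coe.2 hwz, w.2⟩)
    rw [M.coord_eq_zero_of_mem_face hw, mul_zero, inner_sub_right, hn.inner_eq hy hw, sub_self]

variable (M K z) in
theorem exists_isOuterNormal_oppFacet : ∃ n, M.IsOuterNormal K (M.oppFacet K z) n := by
  set c := (M.basis K).coord z
  set g := (InnerProductSpace.toDual ℝ (Space d)).symm c.linear.toContinuousLinearMap with hg
  have hinner (x y : Space d) : inner ℝ g (x - y) = c x - c y := by
    rw [hg, InnerProductSpace.toDual_symm_apply]
    exact c.linearMap_vsub x y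
  have hface (y) (hy : y ∈ (M.oppFacet K z).1) : c y = 0 :=
    M.coord_eq_zero_of_mem_face (M.subset_face _ hy)
  have hz : c z = 1 := M.coord_self K z
  have hg₀ : 0 < ‖g‖ := by
    obtain ⟨y, hy⟩ := M.facet_nonempty (M.oppFacet K z)
    refine norm_pos_iff.2 fun h₀ => zero_ne_one (α := ℝ) ?_
    simpa [h₀, hface y hy, hz] using hinner z y
  refine ⟨-(‖g‖⁻¹ • g), ?_, fun x hx y hy => ?_, fun x hx w hwK hwe => ?_⟩
  · rw [norm_neg, norm_smul, norm_inv, norm_norm, inv_mul_cancel₀ hg₀.ne']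
  · rw [inner_neg_left, real_inner_smul_left, hinner, hface x hx, hface y hy, sub_zero, mul_zero,
      neg_zero]
  · obtain rfl : w = z := by
      by_contra hwz
      exact hwe (M.mem_oppFacet.2 ⟨hwz, hwK⟩)
    rw [inner_neg_left, real_inner_smul_left, hinner, hface x hx, hz, sub_zero, mul_one]
    exact neg_neg_of_pos (inv_pos.2 hg₀)

theorem IsOuterNormal.volume_cell (hn : M.IsOuterNormal K (M.oppFacet K z) n) {y : Space d}
    (hy : y ∈ M.face (M.oppFacet K z)) :
    volume (M.cell K) = ENNReal.ofReal (inner ℝ n (y - z) / d) *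
      (μHE[d - 1] : Measure (Space d)) (M.face (M.oppFacet K z)) := by
  have hmeas := (M.isCompact_cell K).measurableSet
  rw [M.cell_eq_convexJoin K z] at hmeas ⊢
  have hcone := volume_convexJoin_singleton hn.1 (hn.inner_sub_pos hy)
    (fun x hx => by rw [inner_sub_right, inner_sub_right, hn.inner_eq hx hy]) hmeas
  rwa [finrank_euclideanSpace_fin] at hcone

end OppFacet

theorem exists_isOuterNormal {K : M.Elem} {e : M.Facet} (h : e.1 ⊆ K.1) :
    ∃ n, M.IsOuterNormal K e n := by
  obtain ⟨z, rfl⟩ := M.exists_eq_oppFacet h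
  exact M.exists_isOuterNormal_oppFacet K z

theorem exists_volume_cell_eq_mul_measure_face {K : M.Elem} {e : M.Facet} (h : e.1 ⊆ K.1) :
    ∃ c : ℝ, volume (M.cell K) =
      ENNReal.ofReal c * (μHE[d - 1] : Measure (Space d)) (M.face e) := by
  obtain ⟨z, rfl⟩ := M.exists_eq_oppFacet h
  obtain ⟨n, hn⟩ := M.exists_isOuterNormal_oppFacet K z
  obtain ⟨y, hy⟩ := M.face_nonempty (M.oppFacet K z)
  exact ⟨_, hn.volume_cell hy⟩

variable (M)

theorem normal_spec (e : M.Facet) : M.IsOuterNormal (M.plus e) e (M.normal e) :=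
  Classical.epsilon_spec (p := M.IsOuterNormal (M.plus e) e)
    (exists_isOuterNormal (M.plus_spec e))

theorem measure_face_ne_zero (e : M.Facet) : (μHE[d - 1] : Measure (Space d)) (M.face e) ≠ 0 := by
  obtain ⟨c, hvol⟩ := exists_volume_cell_eq_mul_measure_face (M.plus_spec e)
  exact right_ne_zero_of_mul (hvol ▸ (M.volume_cell_pos _).ne')

theorem measure_face_ne_top (e : M.Facet) : (μHE[d - 1] : Measure (Space d)) (M.face e) ≠ ⊤ := by
  obtain ⟨c, hvol⟩ := exists_volume_cell_eq_mul_measure_face (M.plus_spec e)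
  intro htop
  have hc := left_ne_zero_of_mul (hvol ▸ (M.volume_cell_pos _).ne')
  rw [htop, ENNReal.mul_top hc] at hvol
  exact (M.isCompact_cell _).measure_lt_top.ne hvol

theorem faceMeasure_pos (e : M.Facet) : 0 < M.faceMeasure e :=
  ENNReal.toReal_pos (M.measure_face_ne_zero e) (M.measure_face_ne_top e)

variable {M} in
/-- Both sides are `d` times the signed volume of the cone over the facet with apex `x`. -/
theorem IsOuterNormal.faceMeasure_mul_inner {K : M.Elem} {z : K.1} {n : Space d}
    (hn : M.IsOuterNormal K (M.oppFacet K z) n) {y : Space d} (hy : y ∈ M.face (M.oppFacet K z))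
    (x : Space d) : M.faceMeasure (M.oppFacet K z) * inner ℝ n (y - x) =
      d * volume.real (M.cell K) * (M.basis K).coord z x := by
  have hd : (d : ℝ) ≠ 0 := NeZero.ne _
  have hvol : volume.real (M.cell K) =
      inner ℝ n (y - z) / d * M.faceMeasure (M.oppFacet K z) := by
    have hheight := div_nonneg (hn.inner_sub_pos hy).le d.cast_nonneg
    rw [measureReal_def, hn.volume_cell hy, ENNReal.toReal_mul, ENNReal.toReal_ofReal hheight,
      faceMeasure, measureReal_def]
  rw [hvol, hn.inner_sub_eq_mul_coord hy]
  field_simp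

end NeZero

/-! ### Connectedness of the dual graph -/

/-- The dual graph of the mesh, whose vertices are the elements: two distinct elements are adjacent
if they share a facet. -/
def dualGraph : SimpleGraph M.Elem where
  Adj K L := K ≠ L ∧ ∃ e : M.Facet, e.1 ⊆ K.1 ∧ e.1 ⊆ L.1
  symm := ⟨fun _ _ ⟨hne, e, hK, hL⟩ => ⟨hne.symm, e, hL, hK⟩⟩
  loopless := ⟨fun _ h => h.1 rfl⟩

theorem closure_eq_iUnion_cell : closure Ω = ⋃ K, M.cell K := by
  ext x
  rw [← M.cover, Geometry.SimplicialComplex.mem_space_iff, Set.mem_iUnion]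
  constructor
  · rintro ⟨s, hs, hx⟩
    obtain ⟨K, hK, hsK, hcard⟩ := M.pure s hs
    exact ⟨⟨K, hK, hcard⟩, convexHull_mono (Finset.coe_subset.2 hsK) hx⟩
  · rintro ⟨K, hx⟩
    exact ⟨K.1, K.2.1, hx⟩

theorem interior_cell_subset (hΩ : interior (closure Ω) = Ω) (K : M.Elem) :
    interior (M.cell K) ⊆ Ω := by
  refine (interior_mono ?_).trans hΩ.subset
  rw [M.closure_eq_iUnion_cell]
  exact Set.subset_iUnion _ K

variable {M}

theorem nonempty_inter_interior_cell {K : M.Elem} {x : Space d} (hx : x ∈ M.cell K)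
    {B : Set (Space d)} (hB : IsOpen B) (hxB : x ∈ B) : (B ∩ interior (M.cell K)).Nonempty := by
  have hclosure := (M.convex_cell K).closure_interior_eq_closure_of_nonempty_interior
    (M.interior_cell_nonempty K)
  exact mem_closure_iff.1 (hclosure ▸ subset_closure hx) B hB hxB

theorem card_inter_le [DecidableEq (Space d)] {K L : M.Elem} (hKL : K ≠ L) :
    (K.1 ∩ L.1).card ≤ d := by
  by_contra! hlt
  have hK : K.1 ∩ L.1 = K.1 :=
    Finset.eq_of_subset_of_card_le Finset.inter_subset_left (K.2.2.trans_le hlt)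
  have hL : K.1 ∩ L.1 = L.1 :=
    Finset.eq_of_subset_of_card_le Finset.inter_subset_right (L.2.2.trans_le hlt)
  exact hKL (Subtype.ext (hK.symm.trans hL))

theorem cell_inter_cell_subset [DecidableEq (Space d)] (K L : M.Elem) :
    M.cell K ∩ M.cell L ⊆ convexHull ℝ ((K.1 ∩ L.1 : Finset (Space d)) : Set (Space d)) := by
  rw [Finset.coe_inter]
  exact M.complex.inter_subset_convexHull K.2.1 L.2.1

theorem dualGraph_adj_of_mem_cell {K L : M.Elem} (hKL : K ≠ L) {y : Space d} (hK : y ∈ M.cell K)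
    (hL : y ∈ M.cell L)
    (hy : ∀ s ∈ M.complex.faces, s.card < d → y ∉ affineSpan ℝ (s : Set (Space d))) :
    M.dualGraph.Adj K L := by
  classical
  have hyKL := cell_inter_cell_subset K L ⟨hK, hL⟩
  have hface : K.1 ∩ L.1 ∈ M.complex.faces := by
    refine M.complex.down_closed K.2.1 Finset.inter_subset_left (Finset.coe_nonempty.1 ?_)
    exact convexHull_nonempty_iff.1 ⟨y, hyKL⟩
  have hcard : (K.1 ∩ L.1).card = d := (card_inter_le hKL).eq_of_not_lt fun hlt =>
    hy _ hface hlt (convexHull_subset_affineSpan _ hyKL)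
  exact ⟨hKL, ⟨_, hface, hcard⟩, Finset.inter_subset_left, Finset.inter_subset_right⟩

theorem exists_mem_cell_inter_cell {T : Set (Space d)} (hT : IsPreconnected T)
    (hTΩ : T ⊆ closure Ω) {S : Set M.Elem} {K L : M.Elem} (hK : K ∈ S) (hL : L ∉ S)
    (hTK : (T ∩ M.cell K).Nonempty) (hTL : (T ∩ M.cell L).Nonempty) :
    ∃ K' ∈ S, ∃ L' ∉ S, (T ∩ (M.cell K' ∩ M.cell L')).Nonempty := by
  have hclosed (R : Set M.Elem) : IsClosed (⋃ K ∈ R, M.cell K) :=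
    R.toFinite.isClosed_biUnion fun K _ => (M.isCompact_cell K).isClosed
  have hcover : T ⊆ (⋃ K ∈ S, M.cell K) ∪ ⋃ K ∈ Sᶜ, M.cell K := by
    rw [← Set.biUnion_union, Set.union_compl_self, Set.biUnion_univ, ← M.closure_eq_iUnion_cell]
    exact hTΩ
  obtain ⟨x, hxT, hxS, hxSc⟩ := isPreconnected_closed_iff.1 hT _ _ (hclosed S) (hclosed Sᶜ) hcover
    (hTK.mono (Set.inter_subset_inter_right _ (Set.subset_biUnion_of_mem hK)))
    (hTL.mono (Set.inter_subset_inter_right _ (Set.subset_biUnion_of_mem (u := M.cell) hL)))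
  obtain ⟨K', hK', hxK'⟩ := Set.mem_iUnion₂.1 hxS
  obtain ⟨L', hL', hxL'⟩ := Set.mem_iUnion₂.1 hxSc
  exact ⟨K', hK', L', hL', x, hxT, hxK', hxL'⟩

/-- A generic short segment near `x` that joins `K` to `L` avoids the faces of codimension two, so
it can leave the elements of `S` only through a facet. -/
theorem exists_dualGraph_adj_of_mem_cell (hΩ : interior (closure Ω) = Ω) {S : Set M.Elem}
    {K L : M.Elem} (hK : K ∈ S) (hL : L ∉ S) {x : Space d} (hxΩ : x ∈ Ω) (hxK : x ∈ M.cell K)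
    (hxL : x ∈ M.cell L) : ∃ K' ∈ S, ∃ L' ∉ S, M.dualGraph.Adj K' L' := by
  obtain ⟨r, hr, hball⟩ := Metric.isOpen_iff.1 isOpen_interior x (hΩ.symm ▸ hxΩ)
  have hnear {K : M.Elem} (hx : x ∈ M.cell K) :
      (Metric.ball x r ∩ interior (M.cell K)).Nonempty :=
    nonempty_inter_interior_cell hx Metric.isOpen_ball (Metric.mem_ball_self hr)
  obtain ⟨a, ⟨haB, haK⟩, b, ⟨hbB, hbL⟩, hab⟩ := exists_segment_disjoint_affineSpan
    (F := {s | s ∈ M.complex.faces ∧ s.card < d}) (Metric.isOpen_ball.inter isOpen_interior)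
    (hnear hxK) (Metric.isOpen_ball.inter isOpen_interior) (hnear hxL)
    (M.finite.subset fun s hs => hs.1)
    fun s hs => hs.2.trans_eq (finrank_euclideanSpace_fin (𝕜 := ℝ)).symm
  have hseg : segment ℝ a b ⊆ closure Ω :=
    ((convex_ball x r).segment_subset haB hbB).trans (hball.trans interior_subset)
  obtain ⟨K', hK', L', hL', y, hy, hyK, hyL⟩ := exists_mem_cell_inter_cell
    (convex_segment a b).isPreconnected hseg hK hL
    ⟨a, left_mem_segment ℝ a b, interior_subset haK⟩
    ⟨b, right_mem_segment ℝ a b, interior_subset hbL⟩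
  exact ⟨K', hK', L', hL', dualGraph_adj_of_mem_cell (ne_of_mem_of_not_mem hK' hL') hyK hyL
    fun s hs hcard => hab y hy s ⟨hs, hcard⟩⟩

variable (M) in
theorem dualGraph_preconnected (hconn : IsPreconnected Ω) (hΩ : interior (closure Ω) = Ω) :
    M.dualGraph.Preconnected := by
  intro K L
  by_contra hL
  have hmeet (K : M.Elem) : (Ω ∩ M.cell K).Nonempty :=
    (M.interior_cell_nonempty K).mono fun _ hx =>
      ⟨M.interior_cell_subset hΩ K hx, interior_subset hx⟩
  obtain ⟨K₁, hK₁, L₁, hL₁, x, hxΩ, hxK, hxL⟩ := exists_mem_cell_inter_cell hconn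
    subset_closure (S := {L | M.dualGraph.Reachable K L}) (.refl K) hL (hmeet K) (hmeet L)
  obtain ⟨K₂, hK₂, L₂, hL₂, hadj⟩ := exists_dualGraph_adj_of_mem_cell hΩ hK₁ hL₁ hxΩ hxK hxL
  exact hL₂ (hK₂.trans hadj.reachable)

/-! ### The two sides of a facet -/

theorem minus_spec {e : M.Facet} (h : M.IsInterior e) :
    M.minus e ≠ M.plus e ∧ e.1 ⊆ (M.minus e).1 := by
  rw [minus, dif_pos h]
  exact h.choose_spec

variable (M)

open Classical in
/-- The sign with which the trace from the element `K` enters the jump on the facet `e`: it is `1`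
for `K⁺`, `-1` for `K⁻` and `0` for all other elements. -/
def side (K : M.Elem) (e : M.Facet) : ℝ := M.jump (fun L _ => if L = K then 1 else 0) e 0

theorem side_plus (e : M.Facet) : M.side (M.plus e) e = 1 := by
  by_cases h : M.IsInterior e
  · simp [side, jump, h, (minus_spec h).1]
  · simp [side, jump, h]

theorem side_minus {e : M.Facet} (h : M.IsInterior e) : M.side (M.minus e) e = -1 := by
  simp [side, jump, h, (minus_spec h).1.symm]

theorem side_of_not_subset {K : M.Elem} {e : M.Facet} (h : ¬ e.1 ⊆ K.1) : M.side K e = 0 := by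
  have hplus : M.plus e ≠ K := fun hK => h (hK ▸ M.plus_spec e)
  by_cases hi : M.IsInterior e
  · have hminus : M.minus e ≠ K := fun hK => h (hK ▸ (minus_spec hi).2)
    simp [side, jump, hplus, hminus]
  · simp [side, jump, hplus, hi]

theorem jump_eq_sum {X : Type} [AddCommGroup X] [Module ℝ X] (g : M.Elem → Space d → X)
    (e : M.Facet) (x : Space d) : M.jump g e x = ∑ K, M.side K e • g K x := by
  classical
  by_cases h : M.IsInterior e <;> simp [side, jump, h, sub_smul, Finset.sum_sub_distrib]

variable {M}

theorem cell_inter_cell_subset_face {K L : M.Elem} {e : M.Facet} (hKL : K ≠ L) (hK : e.1 ⊆ K.1)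
    (hL : e.1 ⊆ L.1) : M.cell K ∩ M.cell L ⊆ M.face e := by
  classical
  have he : e.1 = K.1 ∩ L.1 := Finset.eq_of_subset_of_card_le (Finset.subset_inter hK hL)
    ((card_inter_le hKL).trans_eq e.2.2.symm)
  rw [face, he]
  exact cell_inter_cell_subset K L

theorem eventually_mem_cell {K : M.Elem} {z : K.1} {c : Space d}
    (hc : ∀ w, w ≠ z → 0 < (M.basis K).coord w c) :
    ∀ᶠ x in 𝓝 c, 0 ≤ (M.basis K).coord z x → x ∈ M.cell K := by
  have hpos : ∀ᶠ x in 𝓝 c, ∀ w, w ≠ z → 0 < (M.basis K).coord w x := by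
    refine eventually_all.2 fun w => eventually_imp_distrib_left.2 fun hw => ?_
    exact (continuous_barycentric_coord _ w).continuousAt.eventually_const_lt (hc w hw)
  filter_upwards [hpos] with x hx hz
  refine M.mem_cell_iff.2 fun w => ?_
  rcases eq_or_ne w z with rfl | hw
  exacts [hz, (hx w hw).le]

section NeZero

variable [NeZero d]

theorem exists_mem_face_coord_pos (K : M.Elem) (z : K.1) :
    ∃ c ∈ M.face (M.oppFacet K z), ∀ w, w ≠ z → 0 < (M.basis K).coord w c := by
  classical
  set s := (Finset.univ : Finset K.1).erase z with hs
  have hcard : s.card = d := by simp [hs, K.2.2]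
  have hpos (w) (hw : w ≠ z) : 0 < (M.basis K).coord w (s.centroid ℝ (M.basis K)) := by
    rw [(M.basis K).coord_apply_centroid (Finset.mem_erase.2 ⟨hw, Finset.mem_univ _⟩), hcard]
    exact inv_pos.2 (Nat.cast_pos.2 (NeZero.pos d))
  have hz : (M.basis K).coord z (s.centroid ℝ (M.basis K)) = 0 :=
    (M.basis K).coord_apply_combination_of_notMem (Finset.notMem_erase _ _)
      (s.sum_centroidWeights_eq_one_of_card_ne_zero ℝ (by rw [hcard]; exact NeZero.ne d))
  refine ⟨_, M.mem_face_oppFacet_iff.2 ⟨M.mem_cell_iff.2 fun w => ?_, hz⟩, hpos⟩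
  rcases eq_or_ne w z with rfl | hw
  exacts [hz.ge, (hpos w hw).le]

theorem coord_neg_of_mem_of_notMem {K L : M.Elem} {z : K.1} (hKL : K ≠ L)
    (hL : (M.oppFacet K z).1 ⊆ L.1) {w : Space d} (hwL : w ∈ L.1)
    (hw : w ∉ (M.oppFacet K z).1) : (M.basis K).coord z w < 0 := by
  by_contra! hnonneg
  obtain ⟨c, hc, hpos⟩ := exists_mem_face_coord_pos K z
  have hlim : Tendsto (AffineMap.lineMap c w : ℝ → Space d) (𝓝[>] 0) (𝓝 c) := by
    have hcont : Continuous (AffineMap.lineMap c w : ℝ → Space d) := AffineMap.lineMap_continuous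
    simpa using (hcont.tendsto 0).mono_left nhdsWithin_le_nhds
  obtain ⟨t, htK, ht⟩ := ((hlim.eventually (eventually_mem_cell hpos)).and
    (Ioo_mem_nhdsGT (zero_lt_one (α := ℝ)))).exists
  have hmem : AffineMap.lineMap c w t ∈ M.face (M.oppFacet K z) := by
    refine cell_inter_cell_subset_face hKL (M.oppFacet_subset K z) hL ⟨htK ?_, ?_⟩
    · rw [AffineMap.apply_lineMap, M.coord_eq_zero_of_mem_face hc, AffineMap.lineMap_apply_ring,
        mul_zero, zero_add]
      exact mul_nonneg ht.1.le hnonneg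
    · refine (M.convex_cell L).segment_subset (convexHull_mono (Finset.coe_subset.2 hL) hc)
        (subset_convexHull ℝ _ hwL) ?_
      rw [segment_eq_image_lineMap]
      exact Set.mem_image_of_mem _ ⟨ht.1.le, ht.2.le⟩
  obtain ⟨z', hz'⟩ := M.exists_eq_oppFacet hL
  have hwz' : w = z' := by
    by_contra hne
    exact hw (hz' ▸ M.mem_oppFacet.2 ⟨hne, hwL⟩)
  rw [hz'] at hmem hc
  have hcoord := M.coord_eq_zero_of_mem_face hmem
  rw [AffineMap.apply_lineMap, M.coord_eq_zero_of_mem_face hc, hwz', M.coord_self,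
    AffineMap.lineMap_apply_ring, mul_zero, mul_one, zero_add] at hcoord
  exact ht.1.ne' hcoord

theorem IsOuterNormal.neg {K L : M.Elem} {e : M.Facet} {n : Space d} (hn : M.IsOuterNormal K e n)
    (hK : e.1 ⊆ K.1) (hL : e.1 ⊆ L.1) (hKL : K ≠ L) : M.IsOuterNormal L e (-n) := by
  obtain ⟨z, rfl⟩ := M.exists_eq_oppFacet hK
  refine ⟨by rw [norm_neg, hn.1], fun x hx y hy => ?_, fun x hx w hwL hw => ?_⟩
  · rw [inner_neg_left, hn.2.1 x hx y hy, neg_zero]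
  · have hx' := M.subset_face _ hx
    rw [inner_neg_left, ← inner_neg_right, neg_sub, hn.inner_sub_eq_mul_coord hx']
    exact mul_neg_of_pos_of_neg (hn.inner_sub_pos hx') (coord_neg_of_mem_of_notMem hKL hL hwL hw)

theorem IsOuterNormal.not_isOuterNormal_neg {K : M.Elem} {e : M.Facet} {n : Space d}
    (hn : M.IsOuterNormal K e n) (h : e.1 ⊆ K.1) : ¬ M.IsOuterNormal K e (-n) := by
  intro hneg
  obtain ⟨z, rfl⟩ := M.exists_eq_oppFacet h
  obtain ⟨y, hy⟩ := M.face_nonempty (M.oppFacet K z)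
  have hpos := hneg.inner_sub_pos hy
  rw [inner_neg_left] at hpos
  exact (neg_pos.1 hpos).not_gt (hn.inner_sub_pos hy)

theorem eq_plus_or_eq_minus {K : M.Elem} {e : M.Facet} (h : e.1 ⊆ K.1) :
    K = M.plus e ∨ (M.IsInterior e ∧ K = M.minus e) := by
  by_contra! hcon
  have hint : M.IsInterior e := ⟨K, hcon.1, h⟩
  obtain ⟨hne, hsub⟩ := minus_spec hint
  have hK := (M.normal_spec e).neg (M.plus_spec e) h hcon.1.symm
  have hminus := (M.normal_spec e).neg (M.plus_spec e) hsub hne.symm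
  exact hK.not_isOuterNormal_neg h (hminus.neg hsub h (hcon.2 hint).symm)

theorem isOuterNormal_side_smul_normal {K : M.Elem} {e : M.Facet} (h : e.1 ⊆ K.1) :
    M.IsOuterNormal K e (M.side K e • M.normal e) := by
  rcases eq_plus_or_eq_minus h with rfl | ⟨hi, rfl⟩
  · rw [side_plus, one_smul]
    exact M.normal_spec e
  · rw [M.side_minus hi, neg_one_smul]
    exact (M.normal_spec e).neg (M.plus_spec e) h (minus_spec hi).1.symm

theorem faceMeasure_mul_side_mul_inner {K : M.Elem} {z : K.1} {y : Space d}
    (hy : y ∈ M.face (M.oppFacet K z)) (x : Space d) :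
    M.faceMeasure (M.oppFacet K z) *
        (M.side K (M.oppFacet K z) * inner ℝ (M.normal (M.oppFacet K z)) (y - x)) =
      d * volume.real (M.cell K) * (M.basis K).coord z x := by
  rw [← real_inner_smul_left]
  exact (isOuterNormal_side_smul_normal (M.oppFacet_subset K z)).faceMeasure_mul_inner hy x

end NeZero

/-! ### Integrals over facets -/

variable (M)

variable {M} in
theorem faceIntegral_congr {e : M.Facet} {f g : Space d → ℝ} (h : ∀ x ∈ M.face e, f x = g x) :
    M.faceIntegral e f = M.faceIntegral e g :=
  setIntegral_congr_fun (M.isCompact_face e).measurableSet h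

theorem faceIntegral_const (e : M.Facet) (c : ℝ) :
    M.faceIntegral e (fun _ => c) = M.faceMeasure e * c := by
  simp [faceIntegral, faceMeasure]

section NeZero

variable [NeZero d]

variable {M} in
theorem integrableOn_face {e : M.Facet} {f : Space d → ℝ} (hf : Continuous f) :
    IntegrableOn f (M.face e) (μHE[d - 1] : Measure (Space d)) := by
  obtain ⟨C, hC⟩ := (M.isCompact_face e).exists_bound_of_continuousOn hf.continuousOn
  exact IntegrableOn.of_bound (M.measure_face_ne_top e).lt_top hf.aestronglyMeasurable C
    (ae_restrict_of_forall_mem (M.isCompact_face e).measurableSet hC)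

theorem eqOn_zero_of_faceIntegral_eq_zero {e : M.Facet} {f : Space d → ℝ} (hf : Continuous f)
    (hnonneg : 0 ≤ f) (h : M.faceIntegral e f = 0) : (M.face e).EqOn f 0 :=
  eqOn_zero_of_setIntegral_eq_zero
    (fun _ hU hne => euclideanHausdorffMeasure_inter_pos (convex_convexHull ℝ _)
      (M.isCompact_face e).isBounded (M.measure_face_ne_zero e) hU hne)
    hf hnonneg (integrableOn_face hf) h

theorem eqOn_face_of_faceIntegral_mul_eq {e : M.Facet} {a b : Space d →ᵃ[ℝ] ℝ}
    (h : ∀ p : Space d →ᵃ[ℝ] ℝ,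
      M.faceIntegral e (fun x => a x * p x) = M.faceIntegral e (fun x => b x * p x)) :
    (M.face e).EqOn a b := by
  have ha : Continuous a := a.continuous_of_finiteDimensional
  have hb : Continuous b := b.continuous_of_finiteDimensional
  have hsq : M.faceIntegral e (fun x => (a x - b x) * (a x - b x)) = 0 := by
    have hab := sub_eq_zero.2 (h (a - b))
    simp only [AffineMap.coe_sub, Pi.sub_apply, faceIntegral] at hab
    rw [← integral_sub (integrableOn_face (by fun_prop)) (integrableOn_face (by fun_prop))] at hab
    simpa only [faceIntegral, ← sub_mul] using hab
  intro x hx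
  have hx₀ := M.eqOn_zero_of_faceIntegral_eq_zero ((ha.sub hb).mul (ha.sub hb))
    (fun x => mul_self_nonneg _) hsq hx
  exact sub_eq_zero.1 (mul_self_eq_zero.1 hx₀)

end NeZero

/-! ### The velocity reconstruction -/

/-- The component of an affine field in the direction `n`. -/
def component (n : Space d) : (Space d →ᵃ[ℝ] Space d) →ₗ[ℝ] Space d →ᵃ[ℝ] ℝ where
  toFun w := (innerₛₗ ℝ n).toAffineMap.comp w
  map_add' v w := by ext x; simp [inner_add_right]
  map_smul' c w := by ext x; simp [inner_smul_right]

theorem component_apply (n : Space d) (w : Space d →ᵃ[ℝ] Space d) (x : Space d) :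
    component n w x = inner ℝ (w x) n := by
  rw [real_inner_comm]
  rfl

theorem continuous_component (n : Space d) (w : Space d →ᵃ[ℝ] Space d) :
    Continuous (component n w) :=
  (component n w).continuous_of_finiteDimensional

open Classical in
/-- The normal component on the facet `e` that the moment conditions prescribe for `ℛv`. -/
def normalTrace (e : M.Facet) : M.BrokenP1 →ₗ[ℝ] Space d →ᵃ[ℝ] ℝ :=
  if M.IsInterior e then
    component (M.normal e) ∘ₗ
      ((1 / 2 : ℝ) • ((LinearMap.proj (M.plus e) : M.BrokenP1 →ₗ[ℝ] _) +
        LinearMap.proj (M.minus e)))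
  else 0

theorem normalTrace_of_isInterior {e : M.Facet} (h : M.IsInterior e) (v : M.BrokenP1)
    (x : Space d) :
    M.normalTrace e v x = inner ℝ (M.avg (fun K => v K) e x) (M.normal e) := by
  simp only [normalTrace, h, if_true, LinearMap.comp_apply, component_apply, avg]
  rfl

theorem normalTrace_of_not_isInterior {e : M.Facet} (h : ¬ M.IsInterior e) (v : M.BrokenP1) :
    M.normalTrace e v = 0 := by
  rw [normalTrace, if_neg h, LinearMap.zero_apply]

variable {M}

section NeZero

variable [NeZero d]

theorem IsReconstruction.component_eqOn_face {v r : M.BrokenP1} (h : M.IsReconstruction v r)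
    {K : M.Elem} {e : M.Facet} (he : e.1 ⊆ K.1) :
    (M.face e).EqOn (component (M.normal e) (r K)) (M.normalTrace e v) := by
  obtain ⟨hbdm, hint, hbd⟩ := h
  have hplus : (M.face e).EqOn (component (M.normal e) (r (M.plus e))) (M.normalTrace e v) := by
    refine M.eqOn_face_of_faceIntegral_mul_eq fun p => ?_
    simp only [component_apply]
    by_cases hi : M.IsInterior e
    · simp only [M.normalTrace_of_isInterior hi, hint e hi p]
    · simp only [M.normalTrace_of_not_isInterior hi, hbd e hi p, AffineMap.coe_zero, Pi.zero_apply,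
        zero_mul, faceIntegral_const, mul_zero]
  rcases eq_plus_or_eq_minus he with rfl | ⟨hi, rfl⟩
  · exact hplus
  · intro x hx
    rw [← hplus hx, component_apply, component_apply, hbdm e hi x hx]

theorem isReconstruction_iff {v r : M.BrokenP1} : M.IsReconstruction v r ↔
    ∀ (K : M.Elem) (e : M.Facet), e.1 ⊆ K.1 → ∀ x ∈ e.1,
      component (M.normal e) (r K) x = M.normalTrace e v x := by
  refine ⟨fun h K e he x hx => h.component_eqOn_face he (M.subset_face e hx), fun h => ?_⟩
  have hface {K : M.Elem} {e : M.Facet} (he : e.1 ⊆ K.1) :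
      (M.face e).EqOn (component (M.normal e) (r K)) (M.normalTrace e v) := fun x hx =>
    AffineMap.eqOn_affineSpan (fun y hy => h K e he y hy) (convexHull_subset_affineSpan _ hx)
  simp only [IsReconstruction, BDM1, ← component_apply]
  refine ⟨fun e hi x hx => ?_, fun e hi p => faceIntegral_congr fun x hx => ?_, fun e hi p => ?_⟩
  · rw [hface (M.plus_spec e) hx, hface (minus_spec hi).2 hx]
  · rw [hface (M.plus_spec e) hx, M.normalTrace_of_isInterior hi]
  · rw [faceIntegral_congr (g := fun _ => 0) fun x hx => ?_, faceIntegral_const, mul_zero]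
    rw [hface (M.plus_spec e) hx, M.normalTrace_of_not_isInterior hi, AffineMap.coe_zero,
      Pi.zero_apply, zero_mul]

theorem exists_inner_normal_eq_mul_coord_linear (K : M.Elem) (z : K.1) : ∃ c : ℝ, c ≠ 0 ∧
    ∀ v, inner ℝ v (M.normal (M.oppFacet K z)) = c * ((M.basis K).coord z).linear v := by
  obtain ⟨y, hy⟩ := M.face_nonempty (M.oppFacet K z)
  have hn := isOuterNormal_side_smul_normal (M.oppFacet_subset K z)
  set s := M.side K (M.oppFacet K z)
  set n := M.normal (M.oppFacet K z)
  have hs : s ≠ 0 := fun hs => by simpa [hs] using hn.1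
  refine ⟨-(inner ℝ (s • n) (y - z) / s), neg_ne_zero.2 (div_ne_zero (hn.inner_sub_pos hy).ne' hs),
    fun v => ?_⟩
  have hv := hn.inner_sub_eq_mul_coord hy (v +ᵥ y)
  rw [AffineMap.map_vadd, M.coord_eq_zero_of_mem_face hy, vadd_eq_add, vadd_eq_add, add_zero,
    sub_add_cancel_right, inner_neg_right, real_inner_smul_left, real_inner_comm] at hv
  field_simp
  linarith

theorem existsUnique_inner_normal_eq (K : M.Elem) (z : K.1) (c : {w : K.1 // w ≠ z} → ℝ) :
    ∃! a : Space d, ∀ w, inner ℝ a (M.normal (M.oppFacet K w.1)) = c w := by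
  choose t ht₀ ht using exists_inner_normal_eq_mul_coord_linear K
  have h := existsUnique_coord_linear_eq (M.basis K) z fun w => c w / t w.1
  simpa only [ht, eq_div_iff (ht₀ _), mul_comm] using h

variable (M)

theorem existsUnique_isReconstruction (v : M.BrokenP1) : ∃! r, M.IsReconstruction v r := by
  choose a ha ha_unique using fun (K : M.Elem) (z : K.1) => existsUnique_inner_normal_eq K z
    fun w => M.normalTrace (M.oppFacet K w.1) v z
  choose r hr hr_unique using fun K => existsUnique_affineMap_apply_eq (M.basis K) (a K)
  refine ⟨r, isReconstruction_iff.2 fun K e he x hx => ?_, fun r' hr' => funext fun K => ?_⟩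
  · obtain ⟨w, rfl⟩ := M.exists_eq_oppFacet he
    obtain ⟨hxw, hxK⟩ := M.mem_oppFacet.1 hx
    have hra : r K x = a K ⟨x, hxK⟩ := hr K ⟨x, hxK⟩
    rw [component_apply, hra]
    exact ha K ⟨x, hxK⟩ ⟨w, fun h => hxw (congrArg Subtype.val h).symm⟩
  · refine hr_unique K (r' K) fun z => ha_unique K z _ fun ⟨w, hw⟩ => ?_
    rw [← component_apply, basis_apply]
    exact isReconstruction_iff.1 hr' K _ (M.oppFacet_subset K w) z
      (M.mem_oppFacet.2 ⟨Subtype.coe_ne_coe.2 hw.symm, z.2⟩)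

theorem reconstruct_spec (v : M.BrokenP1) : M.IsReconstruction v (M.reconstruct v) :=
  Classical.epsilon_spec (M.existsUnique_isReconstruction v).exists

variable {M}

theorem IsReconstruction.reconstruct_eq {v r : M.BrokenP1} (h : M.IsReconstruction v r) :
    M.reconstruct v = r :=
  (M.existsUnique_isReconstruction v).unique (M.reconstruct_spec v) h

variable (M)

theorem reconstruct_add (v w : M.BrokenP1) :
    M.reconstruct (v + w) = M.reconstruct v + M.reconstruct w := by
  refine IsReconstruction.reconstruct_eq (isReconstruction_iff.2 fun K e he x hx => ?_)
  rw [Pi.add_apply, map_add, map_add, AffineMap.coe_add, AffineMap.coe_add, Pi.add_apply,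
    Pi.add_apply, isReconstruction_iff.1 (M.reconstruct_spec v) K e he x hx,
    isReconstruction_iff.1 (M.reconstruct_spec w) K e he x hx]

theorem reconstruct_smul (c : ℝ) (v : M.BrokenP1) :
    M.reconstruct (c • v) = c • M.reconstruct v := by
  refine IsReconstruction.reconstruct_eq (isReconstruction_iff.2 fun K e he x hx => ?_)
  rw [Pi.smul_apply, map_smul, map_smul, AffineMap.coe_smul, AffineMap.coe_smul, Pi.smul_apply,
    Pi.smul_apply, isReconstruction_iff.1 (M.reconstruct_spec v) K e he x hx]

end NeZero

variable (M)

/-! ### The load -/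

theorem measurable_field (r : M.BrokenP1) : Measurable (M.field r) := by
  unfold field glue
  exact Finset.measurable_sum _ fun K _ => Measurable.ite isOpen_interior.measurableSet
    (r K).continuous_of_finiteDimensional.measurable measurable_const

theorem exists_norm_field_le (r : M.BrokenP1) : ∃ C, ∀ x, ‖M.field r x‖ ≤ C := by
  have hbdd (K : M.Elem) : ∃ C, ∀ x ∈ M.cell K, ‖r K x‖ ≤ C :=
    (M.isCompact_cell K).exists_bound_of_continuousOn
      (r K).continuous_of_finiteDimensional.continuousOn
  choose C hC using hbdd
  refine ⟨∑ K, |C K|, fun x => (norm_sum_le _ _).trans (Finset.sum_le_sum fun K _ => ?_)⟩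
  split_ifs with hx
  · exact (hC K x (interior_subset hx)).trans (le_abs_self _)
  · rw [norm_zero]
    exact abs_nonneg _

theorem integrableOn_inner_field {s : Set (Space d)} {f : Space d → Space d}
    (hf : IntegrableOn f s) (r : M.BrokenP1) :
    IntegrableOn (fun x => inner ℝ (f x) (M.field r x)) s := by
  obtain ⟨C, hC⟩ := M.exists_norm_field_le r
  refine (hf.norm.mul_const C).mono' (hf.1.inner (M.measurable_field r).aestronglyMeasurable)
    (ae_of_all _ fun x => (norm_inner_le_norm _ _).trans ?_)
  gcongr
  exact hC x

/-- The load `v ↦ (f, ℛv)` as a linear functional. -/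
def loadLinear [NeZero d] {f : Space d → Space d} (hf : IntegrableOn f Ω) :
    M.BrokenP1 →ₗ[ℝ] ℝ where
  toFun := M.load f
  map_add' v w := by
    simp only [load, reconstruct_add, field_add, Pi.add_apply, inner_add_right]
    exact integral_add (M.integrableOn_inner_field hf _) (M.integrableOn_inner_field hf _)
  map_smul' c v := by
    simp only [load, reconstruct_smul, field_smul, Pi.smul_apply, inner_smul_right]
    exact integral_const_mul _ _

/-! ### The divergence form -/

/-- The average `{q}` on the facet `e` of a piecewise constant function. -/
def avgConst (e : M.Facet) : M.BrokenP0 →ₗ[ℝ] ℝ where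
  toFun q := M.avg (fun K _ => q K) e 0
  map_add' p q := by
    simp only [avg, Pi.add_apply, smul_eq_mul]
    split_ifs <;> ring
  map_smul' c q := by
    simp only [avg, Pi.smul_apply, smul_eq_mul, RingHom.id_apply]
    split_ifs <;> ring

theorem avg_const (e : M.Facet) (q : M.BrokenP0) (x : Space d) :
    M.avg (fun K _ => q K) e x = M.avgConst e q :=
  rfl

theorem avgConst_le {q : M.BrokenP0} {c : ℝ} (h : ∀ K, q K ≤ c) (e : M.Facet) :
    M.avgConst e q ≤ c := by
  rw [← M.avg_const e q 0, avg, smul_eq_mul]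
  split_ifs
  · linarith [h (M.plus e), h (M.minus e)]
  · exact h (M.plus e)

section NeZero

variable [NeZero d]

/-- The flux of an affine field through a facet. -/
def flux (e : M.Facet) : (Space d →ᵃ[ℝ] Space d) →ₗ[ℝ] ℝ where
  toFun w := M.faceIntegral e (component (M.normal e) w)
  map_add' v w := by
    rw [map_add]
    exact integral_add (integrableOn_face (continuous_component _ v))
      (integrableOn_face (continuous_component _ w))
  map_smul' c v := by
    rw [map_smul]
    exact integral_const_mul c _

/-- The flux of the jump `⟦w⟧` through a facet. -/
def jumpFlux (e : M.Facet) : M.BrokenP1 →ₗ[ℝ] ℝ :=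
  ∑ K, M.side K e • M.flux e ∘ₗ LinearMap.proj K

theorem jumpFlux_apply (e : M.Facet) (w : M.BrokenP1) :
    M.jumpFlux e w = ∑ K, M.side K e * M.flux e (w K) := by
  simp [jumpFlux]

theorem faceIntegral_inner_jump (e : M.Facet) (w : M.BrokenP1) :
    M.faceIntegral e (fun x => inner ℝ (M.jump (fun K => w K) e x) (M.normal e)) =
      M.jumpFlux e w := by
  simp only [jump_eq_sum, sum_inner, real_inner_smul_left, ← component_apply, faceIntegral]
  rw [integral_finsetSum _ fun K _ =>
    (integrableOn_face (continuous_component _ (w K))).const_mul _, jumpFlux_apply]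
  simp only [integral_const_mul]
  rfl

theorem formB_eq (w : M.BrokenP1) (q : M.BrokenP0) : M.formB w q =
    ∑ K, volume.real (M.cell K) * LinearMap.trace ℝ (Space d) (w K).linear * q K -
      ∑ e, M.jumpFlux e w * M.avgConst e q := by
  simp only [formB, setIntegral_const, smul_eq_mul, avg_const, ← faceIntegral_inner_jump,
    faceIntegral, integral_mul_const, mul_assoc]

/-- The form `b` as a bilinear map. -/
def bilinB : M.BrokenP1 →ₗ[ℝ] M.BrokenP0 →ₗ[ℝ] ℝ :=
  LinearMap.mk₂ ℝ M.formB
    (fun v w q => by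
      simp only [formB_eq, Pi.add_apply, AffineMap.add_linear, map_add, mul_add, add_mul,
        Finset.sum_add_distrib]
      ring)
    (fun c v q => by
      simp only [formB_eq, Pi.smul_apply, AffineMap.smul_linear, map_smul, smul_eq_mul, mul_sub,
        Finset.mul_sum, mul_left_comm, mul_assoc])
    (fun v p q => by
      simp only [formB_eq, Pi.add_apply, map_add, mul_add, Finset.sum_add_distrib]
      ring)
    (fun c v q => by
      simp only [formB_eq, Pi.smul_apply, map_smul, smul_eq_mul, mul_sub, Finset.mul_sum,
        mul_left_comm])

end NeZero

/-- The affine field `x ↦ x - a`. -/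
def radial (a : Space d) : Space d →ᵃ[ℝ] Space d :=
  AffineMap.id ℝ (Space d) - AffineMap.const ℝ (Space d) a

theorem radial_apply (a x : Space d) : radial a x = x - a := rfl

theorem trace_radial (a : Space d) : LinearMap.trace ℝ (Space d) (radial a).linear = d := by
  have hlinear : (radial a).linear = LinearMap.id := by
    ext1 x
    simp [radial]
  rw [hlinear, LinearMap.trace_id, finrank_euclideanSpace_fin]

section NeZero

variable [NeZero d]

theorem flux_radial {e : M.Facet} {y : Space d} (hy : y ∈ M.face e) (a : Space d) :
    M.flux e (radial a) = M.faceMeasure e * inner ℝ (M.normal e) (y - a) := by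
  rw [← faceIntegral_const]
  refine faceIntegral_congr fun x hx => ?_
  rw [component_apply, radial_apply, real_inner_comm, inner_sub_right, inner_sub_right,
    (M.normal_spec e).inner_eq hx hy]

theorem side_mul_flux_radial (K : M.Elem) (z : K.1) (a : Space d) :
    M.side K (M.oppFacet K z) * M.flux (M.oppFacet K z) (radial a) =
      d * volume.real (M.cell K) * (M.basis K).coord z a := by
  obtain ⟨y, hy⟩ := M.face_nonempty (M.oppFacet K z)
  rw [M.flux_radial hy, mul_left_comm, faceMeasure_mul_side_mul_inner hy]

theorem sum_side_mul_flux_radial (K : M.Elem) (a : Space d) :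
    ∑ e, M.side K e * M.flux e (radial a) = d * volume.real (M.cell K) := by
  rw [M.sum_eq_sum_oppFacet fun e he => by rw [M.side_of_not_subset he, zero_mul]]
  simp only [side_mul_flux_radial, ← Finset.mul_sum, (M.basis K).sum_coord_apply_eq_one, mul_one]

/-- If there were no boundary facet, then the flux of `x ↦ x` out of the elements would cancel. -/
theorem exists_not_isInterior [Nonempty M.Elem] : ∃ e, ¬ M.IsInterior e := by
  by_contra! hint
  have hside (e : M.Facet) : ∑ K, M.side K e = 0 := by
    have hjump := M.jump_eq_sum (fun _ _ => (1 : ℝ)) e 0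
    rw [jump, if_pos (hint e), sub_self] at hjump
    simpa using hjump.symm
  have hsum : ∑ K, d * volume.real (M.cell K) = 0 := by
    simp only [← M.sum_side_mul_flux_radial _ 0]
    rw [Finset.sum_comm]
    simp only [← Finset.sum_mul, hside, zero_mul, Finset.sum_const_zero]
  have hpos : 0 < ∑ K, d * volume.real (M.cell K) := Finset.sum_pos
    (fun K _ => mul_pos (Nat.cast_pos.2 (NeZero.pos d)) (M.volumeReal_cell_pos K))
    Finset.univ_nonempty
  exact hpos.ne' hsum

end NeZero

theorem coord_centroid (K : M.Elem) (z : K.1) :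
    (M.basis K).coord z (M.centroid K) = ((d : ℝ) + 1)⁻¹ := by
  have hcentroid : M.centroid K = Finset.univ.centroid ℝ (M.basis K) :=
    (Finset.centroid_univ ℝ K.1).symm
  rw [hcentroid, (M.basis K).coord_apply_centroid (Finset.mem_univ z), Finset.card_univ,
    Fintype.card_coe, K.2.2, Nat.cast_add_one]

open Classical in
/-- The basis function of `D_h` supported in `K`. -/
def enrichment (K : M.Elem) : M.BrokenP1 := Pi.single K (radial (M.centroid K))

theorem enrichment_mem_velocity (K : M.Elem) : M.enrichment K ∈ M.velocity := by
  classical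
  refine Submodule.mem_sup_right ⟨Pi.single K 1, fun L x => ?_⟩
  rcases eq_or_ne L K with rfl | h
  · simp [enrichment, radial_apply]
  · simp [enrichment, h]

section NeZero

variable [NeZero d]

theorem formB_enrichment (K : M.Elem) (q : M.BrokenP0) : M.formB (M.enrichment K) q =
    d * volume.real (M.cell K) / (d + 1) *
      ∑ z, (q K - M.avgConst (M.oppFacet K z) q) := by
  classical
  have hjumpFlux (e : M.Facet) :
      M.jumpFlux e (M.enrichment K) = M.side K e * M.flux e (radial (M.centroid K)) := by
    rw [jumpFlux_apply, Finset.sum_eq_single K (fun L _ h => by simp [enrichment, h]) (by simp),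
      enrichment, Pi.single_eq_same]
  have hsum : ∑ e, M.jumpFlux e (M.enrichment K) * M.avgConst e q =
      ∑ z, d * volume.real (M.cell K) / (d + 1) * M.avgConst (M.oppFacet K z) q := by
    rw [M.sum_eq_sum_oppFacet fun e he => by
      rw [hjumpFlux, M.side_of_not_subset he, zero_mul, zero_mul]]
    simp only [hjumpFlux, side_mul_flux_radial, coord_centroid, div_eq_mul_inv]
  rw [formB_eq, hsum, Finset.sum_eq_single K (fun L _ h => by simp [enrichment, h]) (by simp),
    enrichment, Pi.single_eq_same, trace_radial, ← Finset.mul_sum, Finset.sum_sub_distrib,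
    Finset.sum_const, Finset.card_univ, Fintype.card_coe, K.2.2, nsmul_eq_mul, Nat.cast_add_one]
  field_simp

variable {M}

theorem isInterior_and_eq_of_subset {K L : M.Elem} {e : M.Facet} (hKL : K ≠ L) (hK : e.1 ⊆ K.1)
    (hL : e.1 ⊆ L.1) : M.IsInterior e ∧
      (K = M.plus e ∧ L = M.minus e ∨ K = M.minus e ∧ L = M.plus e) := by
  rcases eq_plus_or_eq_minus hK with hK | ⟨hi, hK⟩ <;>
    rcases eq_plus_or_eq_minus hL with hL | ⟨hj, hL⟩
  exacts [absurd (hK.trans hL.symm) hKL, ⟨hj, .inl ⟨hK, hL⟩⟩, ⟨hi, .inr ⟨hK, hL⟩⟩,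
    absurd (hK.trans hL.symm) hKL]

theorem avgConst_eq_of_subset {K L : M.Elem} {e : M.Facet} (hKL : K ≠ L) (hK : e.1 ⊆ K.1)
    (hL : e.1 ⊆ L.1) (q : M.BrokenP0) : M.avgConst e q = (q K + q L) / 2 := by
  obtain ⟨hi, ⟨rfl, rfl⟩ | ⟨rfl, rfl⟩⟩ := isInterior_and_eq_of_subset hKL hK hL <;>
  · rw [← M.avg_const _ q 0, avg, if_pos hi, smul_eq_mul]
    ring

/-- If `q` is maximal at `K`, then all the facet contributions to `b(φ_K, q)` are nonnegative. -/
theorem eq_of_formB_enrichment_eq_zero {K L : M.Elem} {q : M.BrokenP0}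
    (hmax : ∀ K', q K' ≤ q K) (h : M.formB (M.enrichment K) q = 0) (hadj : M.dualGraph.Adj K L) :
    q L = q K := by
  obtain ⟨hKL, e, heK, heL⟩ := hadj
  obtain ⟨z, rfl⟩ := M.exists_eq_oppFacet heK
  have hd : (0 : ℝ) < d := Nat.cast_pos.2 (NeZero.pos d)
  have hvol := M.volumeReal_cell_pos K
  rw [formB_enrichment] at h
  have hsum := (mul_eq_zero.1 h).resolve_left (by positivity)
  have hz := (Finset.sum_eq_zero_iff_of_nonneg fun w _ =>
    sub_nonneg.2 (M.avgConst_le hmax (M.oppFacet K w))).1 hsum z (Finset.mem_univ z)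
  rw [avgConst_eq_of_subset hKL heK heL] at hz
  linarith

theorem pressure_eq_zero (hconn : IsPreconnected Ω) (hΩ : interior (closure Ω) = Ω)
    {q : M.BrokenP0} (hq : q ∈ M.pressure) (h : ∀ K, M.formB (M.enrichment K) q = 0) : q = 0 := by
  cases isEmpty_or_nonempty M.Elem
  · exact Subsingleton.elim _ _
  obtain ⟨K₀, hmax⟩ := Finite.exists_max q
  have hconst (K : M.Elem) : q K = q K₀ :=
    forall_of_preconnected (p := fun K => q K = q K₀) (M.dualGraph_preconnected hconn hΩ) rfl
      (fun K L hadj hK =>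
        (eq_of_formB_enrichment_eq_zero (hK.symm ▸ hmax) (h K) hadj).trans hK) K
  have hmean : ∑ K, ∫ _ in M.cell K, q K = 0 := hq
  simp only [setIntegral_const, smul_eq_mul, hconst, ← Finset.sum_mul] at hmean
  have hvol : 0 < ∑ K, volume.real (M.cell K) :=
    Finset.sum_pos (fun K _ => M.volumeReal_cell_pos K) Finset.univ_nonempty
  funext K
  rw [hconst, (mul_eq_zero.1 hmean).resolve_left hvol.ne', Pi.zero_apply]

end NeZero

/-! ### Definiteness of the energy norm -/

theorem frobSq_nonneg (A : Space d →ₗ[ℝ] Space d) : 0 ≤ frobSq A :=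
  Finset.sum_nonneg fun _ _ => sq_nonneg _

theorem eq_zero_of_frobSq_eq_zero {A : Space d →ₗ[ℝ] Space d} (h : frobSq A = 0) : A = 0 := by
  rw [frobSq, Finset.sum_eq_zero_iff_of_nonneg fun _ _ => sq_nonneg _] at h
  exact (EuclideanSpace.basisFun (Fin d) ℝ).toBasis.ext fun i => by
    simpa using h i (Finset.mem_univ i)

theorem continuous_jump (v : M.BrokenP1) (e : M.Facet) :
    Continuous fun x => M.jump (fun K => v K) e x := by
  simp only [jump_eq_sum]
  exact continuous_finsetSum _ fun K _ =>
    (v K).continuous_of_finiteDimensional.const_smul (M.side K e)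

variable {M}

section NeZero

variable [NeZero d]

theorem faceSize_pos (e : M.Facet) : 0 < M.faceSize e :=
  Real.rpow_pos_of_pos (M.faceMeasure_pos e) _

theorem linear_eq_zero_and_jump_eq_zero_of_energyNorm_eq_zero {ρ : ℝ} (hρ : 0 < ρ)
    {u : M.BrokenP1} (h : M.energyNorm ρ u = 0) :
    (∀ K, (u K).linear = 0) ∧ ∀ e, ∀ x ∈ M.face e, M.jump (fun K => u K) e x = 0 := by
  have hgrad (K : M.Elem) : 0 ≤ ∫ _ in M.cell K, frobSq (u K).linear :=
    integral_nonneg fun _ => frobSq_nonneg _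
  have hjump (e : M.Facet) (x : Space d) :
      0 ≤ (M.faceSize e)⁻¹ * ‖M.jump (fun K => u K) e x‖ ^ 2 :=
    mul_nonneg (inv_nonneg.2 (faceSize_pos e).le) (sq_nonneg _)
  have hpenalty (e : M.Facet) : 0 ≤ M.faceIntegral e fun x =>
      (M.faceSize e)⁻¹ * ‖M.jump (fun K => u K) e x‖ ^ 2 := integral_nonneg (hjump e)
  have hgrad_sum := Finset.sum_nonneg fun K (_ : K ∈ Finset.univ) => hgrad K
  have hpenalty_sum := Finset.sum_nonneg fun e (_ : e ∈ Finset.univ) => hpenalty e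
  rw [energyNorm, Real.sqrt_eq_zero (by positivity),
    add_eq_zero_iff_of_nonneg hgrad_sum (by positivity), mul_eq_zero_iff_left hρ.ne',
    Finset.sum_eq_zero_iff_of_nonneg fun K _ => hgrad K,
    Finset.sum_eq_zero_iff_of_nonneg fun e _ => hpenalty e] at h
  refine ⟨fun K => eq_zero_of_frobSq_eq_zero ?_, fun e x hx => ?_⟩
  · have hK := h.1 K (Finset.mem_univ K)
    rw [setIntegral_const, smul_eq_mul] at hK
    exact (mul_eq_zero.1 hK).resolve_left (M.volumeReal_cell_pos K).ne'
  · have hzero := M.eqOn_zero_of_faceIntegral_eq_zero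
      (continuous_const.mul ((M.continuous_jump u e).norm.pow 2)) (hjump e)
      (h.2 e (Finset.mem_univ e)) hx
    exact norm_eq_zero.1 (pow_eq_zero_iff two_ne_zero |>.1
      ((mul_eq_zero.1 hzero).resolve_left (inv_pos.2 (faceSize_pos e)).ne'))

theorem eq_of_jump_eq_zero {X : Type} [AddCommGroup X] {g : M.Elem → Space d → X} {K L : M.Elem}
    {e : M.Facet} (hKL : K ≠ L) (hK : e.1 ⊆ K.1) (hL : e.1 ⊆ L.1) {x : Space d}
    (h : M.jump g e x = 0) : g K x = g L x := by
  obtain ⟨hi, hside⟩ := isInterior_and_eq_of_subset hKL hK hL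
  rw [jump, if_pos hi, sub_eq_zero] at h
  obtain ⟨rfl, rfl⟩ | ⟨rfl, rfl⟩ := hside
  exacts [h, h.symm]

theorem eq_zero_of_linear_eq_zero_of_jump_eq_zero (hconn : IsPreconnected Ω)
    (hΩ : interior (closure Ω) = Ω) {u : M.BrokenP1} (hlin : ∀ K, (u K).linear = 0)
    (hjump : ∀ e, ∀ x ∈ M.face e, M.jump (fun K => u K) e x = 0) : u = 0 := by
  cases isEmpty_or_nonempty M.Elem
  · exact Subsingleton.elim _ _
  choose c hc using fun K => (AffineMap.linear_eq_zero_iff_exists_const (u K)).1 (hlin K)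
  have happly (K : M.Elem) (x : Space d) : u K x = c K := by rw [hc, AffineMap.const_apply]
  obtain ⟨e₀, he₀⟩ := M.exists_not_isInterior
  have hbd : c (M.plus e₀) = 0 := by
    obtain ⟨x, hx⟩ := M.face_nonempty e₀
    have hx₀ := hjump e₀ x hx
    rwa [jump, if_neg he₀, happly] at hx₀
  have hadj (K L : M.Elem) (h : M.dualGraph.Adj K L) (hK : c K = 0) : c L = 0 := by
    obtain ⟨hKL, e, heK, heL⟩ := h
    obtain ⟨x, hx⟩ := M.face_nonempty e
    have hx₀ := eq_of_jump_eq_zero hKL heK heL (hjump e x hx)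
    rw [happly, happly] at hx₀
    exact hx₀.symm.trans hK
  have hzero := forall_of_preconnected (M.dualGraph_preconnected hconn hΩ) hbd hadj
  funext K
  ext1 x
  rw [happly, hzero, Pi.zero_apply, AffineMap.coe_zero, Pi.zero_apply]

theorem eq_zero_of_energyNorm_eq_zero (hconn : IsPreconnected Ω) (hΩ : interior (closure Ω) = Ω)
    {ρ : ℝ} (hρ : 0 < ρ) {u : M.BrokenP1} (h : M.energyNorm ρ u = 0) : u = 0 :=
  have ⟨hlin, hjump⟩ := linear_eq_zero_and_jump_eq_zero_of_energyNorm_eq_zero hρ h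
  eq_zero_of_linear_eq_zero_of_jump_eq_zero hconn hΩ hlin hjump

/-! ### Well-posedness -/

theorem eq_zero_of_isSolution_zero (hconn : IsPreconnected Ω) (hΩ : interior (closure Ω) = Ω)
    {ρ α : ℝ} (hρ : 0 < ρ) (hα : 0 < α) {aD : M.velocity →ₗ[ℝ] M.velocity →ₗ[ℝ] ℝ}
    (hcoer : ∀ v : M.velocity, (∀ q : M.pressure, M.formB v q = 0) →
      α * M.energyNorm ρ v ^ 2 ≤ aD v v) {u : M.velocity} {p : M.pressure}
    (hu : ∀ v : M.velocity, aD u v - M.formB v p = 0) (hdiv : ∀ q : M.pressure, M.formB u q = 0) :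
    u = 0 ∧ p = 0 := by
  have henergy : α * M.energyNorm ρ u ^ 2 ≤ 0 := by
    have huu := hu u
    rw [hdiv p, sub_zero] at huu
    exact (hcoer u hdiv).trans_eq huu
  have hnorm : M.energyNorm ρ u = 0 :=
    (pow_eq_zero_iff two_ne_zero).1 ((nonpos_of_mul_nonpos_right henergy hα).antisymm (sq_nonneg _))
  have hu₀ : u = 0 := Subtype.ext (eq_zero_of_energyNorm_eq_zero hconn hΩ hρ hnorm)
  refine ⟨hu₀, Subtype.ext (pressure_eq_zero hconn hΩ p.2 fun K => ?_)⟩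
  have hK := hu ⟨M.enrichment K, M.enrichment_mem_velocity K⟩
  rwa [hu₀, map_zero, LinearMap.zero_apply, zero_sub, neg_eq_zero] at hK

theorem existsUnique_isSolution (hconn : IsPreconnected Ω) (hΩ : interior (closure Ω) = Ω)
    {ρ α : ℝ} (hρ : 0 < ρ) (hα : 0 < α) {aD : M.velocity →ₗ[ℝ] M.velocity →ₗ[ℝ] ℝ}
    (hcoer : ∀ v : M.velocity, (∀ q : M.pressure, M.formB v q = 0) →
      α * M.energyNorm ρ v ^ 2 ≤ aD v v) {f : Space d → Space d} (hf : IntegrableOn f Ω) :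
    ∃! s : M.velocity × M.pressure, M.IsSolution aD f s.1 s.2 :=
  existsUnique_saddlePoint aD (M.bilinB.domRestrict₁₂ M.velocity M.pressure)
    (fun _ _ => eq_zero_of_isSolution_zero hconn hΩ hρ hα hcoer)
    ((M.loadLinear hf).domRestrict M.velocity)

end NeZero

end Mesh

end

end EG

theorem mainTheorem4_general {d : ℕ} (hd : 2 ≤ d) {Ω : Set (EG.Space d)} (hconn : IsPreconnected Ω)
    (hΩ : interior (closure Ω) = Ω) (M : EG.Mesh Ω) {ρ : ℝ} (hρ : 0 < ρ) :
    (∀ v : M.BrokenP1, ∃! r : M.BrokenP1, M.IsReconstruction v r) ∧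
      ∀ f : EG.Space d → EG.Space d, IntegrableOn f Ω →
      ∀ (aD : M.velocity →ₗ[ℝ] M.velocity →ₗ[ℝ] ℝ) (α : ℝ), 0 < α →
        (∀ v : M.velocity, (∀ q : M.pressure, M.formB v q = 0) →
          α * M.energyNorm ρ v ^ 2 ≤ aD v v) →
        ∃! s : M.velocity × M.pressure, M.IsSolution aD f s.1 s.2 := by
  have : NeZero d := ⟨by lia⟩
  exact ⟨M.existsUnique_isReconstruction, fun f hf aD α hα hcoer =>
    EG.Mesh.existsUnique_isSolution hconn hΩ hρ hα hcoer hf⟩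

theorem mainTheorem4 (d : ℕ) (hd : d = 2 ∨ d = 3) (σ : ℝ) :
    ∃ ρ₀ : ℝ, 0 < ρ₀ ∧ ∀ ρ : ℝ, ρ₀ ≤ ρ →
      ∀ (Ω : Set (EG.Space d)), IsOpen Ω → Bornology.IsBounded Ω → IsConnected Ω →
        interior (closure Ω) = Ω →
      ∀ (M : EG.Mesh Ω), M.ShapeRegular σ →
        (∀ v : M.velocity, ∃! r : M.BrokenP1, M.IsReconstruction v r) ∧
        ∀ (ν : ℝ), 0 < ν →
        ∀ (f : EG.Space d → EG.Space d), MemLp f 2 (volume.restrict Ω) →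
        ∀ (aD : M.velocity →ₗ[ℝ] M.velocity →ₗ[ℝ] ℝ) (κ₁ κ₂ : ℝ), 0 < κ₁ → 0 < κ₂ →
          (∀ v : M.velocity, κ₁ * ν * M.energyNorm ρ v ^ 2 ≤ aD v v) →
          (∀ v w : M.velocity, |aD v w| ≤ κ₂ * ν * M.energyNorm ρ v * M.energyNorm ρ w) →
          ∃! s : M.velocity × M.pressure, M.IsSolution aD f s.1 s.2 := by
  refine ⟨1, one_pos, fun ρ hρ Ω _ hb hconn hΩ M _ => ?_⟩
  have : IsFiniteMeasure (volume.restrict Ω) := isFiniteMeasure_restrict.2 hb.measure_lt_top.ne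
  have h := mainTheorem4_general (by lia) hconn.isPreconnected hΩ M (one_pos.trans_le hρ)
  exact ⟨fun v => h.1 v, fun ν hν f hf aD κ₁ _ hκ₁ _ hcoer _ =>
    h.2 f (hf.integrable one_le_two) aD (κ₁ * ν) (mul_pos hκ₁ hν) fun v _ => hcoer v⟩
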